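/- Let $M$ be a finite-dimensional paracompact Hausdorff smooth manifold and let $E\to M$ be an $SU(n)$-vector bundle, $n\ge 1$: a smooth complex vector bundle of rank $n$ with a smooth hermitian metric and a given trivialization of $\bigwedge^n E$ compatible with the metric (a smooth complex volume form that has modulus $1$ on orthonormal frames). Let $C^\infty(M)$ be the algebra of smooth complex-valued functions on $M$, let $\Gamma(TM)=\mathrm{Der}(C^\infty(M))$ be the Lie algebra of (complex) vector fields, and let $\mathfrak A=\Gamma(\mathrm{End}(E))$ be the algebra of smooth endomorphisms of $E$, with center $C^\infty(M)$. Let $\mathrm{Der}(\mathfrak A)$ be the Lie algebra and $C^\infty(M)$-module of derivations of the complex algebra $\mathfrak A$, let $\mathrm{Int}(\mathfrak A)=\{ad_\gamma=[\gamma,\cdot\,]\mid \gamma\in\mathfrak A\}$ be its ideal of inner derivations, and let $\rho:\mathrm{Der}(\mathfrak A)\to\Gamma(TM)$, $\mathcal X\mapsto X$, be the restriction of derivations to the center. Let $\mathcal A(E)$ be the Atiyah algebra of $E$: the Lie algebra and $C^\infty(M)$-module of first-order differential operators $T$ on $\Gamma(E)$ whose symbol is $\mathrm{Id}_E\otimes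 X$ for a vector field $X$ (that is, $T(fs)=fT(s)+(Xf)s$ for $f\in C^\infty(M)$, $s\in\Gamma(E)$); its anchor maps $T$ to $X$. Let $i:\mathfrak A\to\mathcal A(E)$ be the inclusion, and let $\mathcal A(E)\to\mathrm{Der}(\mathfrak A)$ be the map $T\mapsto (S\mapsto[T,S])$. Define $i\theta:\mathrm{Int}(\mathfrak A)\to\mathfrak A$ by $i\theta(ad_\gamma)=\gamma-\frac1n\mathrm{Tr}(\gamma)\mathbf 1$. An $SU(n)$-connection $\nabla^E$ is a connection on $E$ for which the hermitian metric and the trivialization of $\bigwedge^nE$ are covariantly constant. It induces the connection $\nabla_XS=[\nabla^E_X,S]$ on $\mathrm{End}(E)$, and for each $\mathcal X\in\mathrm{Der}(\mathfrak A)$ the derivation $\mathcal X-\nabla_X$ is inner; put $\alpha(\mathcal X)=-i\theta(\mathcal X-\nabla_X)$ and define $$\overset{o}{D}:\mathrm{Der}(\mathfrak A)\to\mathcal A(E),\qquad \overset{o}{D}(\mathcal X)=\nabla^E_X-\alpha(\mathcal X).$$ Then: (i) $\overset{o}{D}$ does not depend on the choice of the $SU(n)$-connection $\nabla^E$. (ii)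 The sequence $0\to C^\infty(M)\to\mathcal A(E)\to\mathrm{Der}(\mathfrak A)\to0$ is exact, both as a sequence of $C^\infty(M)$-modules and as a sequence of Lie algebras, and $\overset{o}{D}$ splits it in both senses: $\overset{o}{D}$ is $C^\infty(M)$-linear, it is a morphism of Lie algebras, and $[\overset{o}{D}(\mathcal X),S]=\mathcal X S$ for all $\mathcal X\in\mathrm{Der}(\mathfrak A)$, $S\in\mathfrak A$. (iii) The sequence $0\to C^\infty(M)\to\mathfrak A\xrightarrow{\,ad\,}\mathrm{Int}(\mathfrak A)\to0$ of $C^\infty(M)$-modules and Lie algebras is exact, $i\theta$ splits it in both senses, and $\overset{o}{D}$ induces this splitting: $\overset{o}{D}(\delta)=i(i\theta(\delta))$ for every $\delta\in\mathrm{Int}(\mathfrak A)$. (iv) $\overset{o}{D}$ is a $\mathrm{Der}(\mathfrak A)$-connection on $E$ in the sense of Lie algebroids, that is, it is $C^\infty(M)$-linear and preserves the anchors (the symbol of $\overset{o}{D}(\mathcal X)$ is $\mathrm{Id}_E\otimes\rho(\mathcal X)$), and its curvature $[\overset{o}{D}(\mathcal X),\overset{o}{D}(\mathcal Y)]-\overset{o}{D}([\mathcal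 X,\mathcal Y])$ vanishes. -/

import Mathlib

set_option linter.unusedSectionVars false

open scoped Manifold ContDiff Bundle Topology
open Bundle

noncomputable section

namespace SUBundle

/-! ### Smooth complex functions and vector fields -/

section Functions

variable {V : Type*} [NormedAddCommGroup V] [NormedSpace ℝ V]
  {M : Type*} [TopologicalSpace M] [ChartedSpace V M]
  {F : Type*} [NormedAddCommGroup F] [NormedSpace ℂ F]

theorem contMDiffAt_smul_complex {f : M → ℂ} {g : M → F} {x : M}
    (hf : ContMDiffAt 𝓘(ℝ, V) 𝓘(ℝ, ℂ) ∞ f x) (hg : ContMDiffAt 𝓘(ℝ, V) 𝓘(ℝ, F) ∞ g x) :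
    ContMDiffAt 𝓘(ℝ, V) 𝓘(ℝ, F) ∞ (fun x => f x • g x) x :=
  (((contDiff_smul (𝕜 := ℂ) (F := F) (n := ∞)).restrict_scalars ℝ).contMDiff.contMDiffAt
    (x := (f x, g x))).comp x (hf.prodMk_space hg)

variable (V M)

/-- The complex-valued smooth functions on `M`, as a subalgebra of all functions. -/
def smoothSubalgebra : Subalgebra ℂ (M → ℂ) where
  carrier := {f | ContMDiff 𝓘(ℝ, V) 𝓘(ℝ, ℂ) ∞ f}
  mul_mem' hf hg := fun x => contMDiffAt_smul_complex (hf x) (hg x)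
  add_mem' hf hg := ContMDiff.add hf hg
  algebraMap_mem' _ := contMDiff_const

/-- The algebra `C^∞(M)` of smooth functions on `M` with values in `ℂ`. -/
def CInf : Type _ := smoothSubalgebra V M

instance : CommRing (CInf V M) := inferInstanceAs (CommRing (smoothSubalgebra V M))
instance : Algebra ℂ (CInf V M) := inferInstanceAs (Algebra ℂ (smoothSubalgebra V M))
instance : CoeFun (CInf V M) (fun _ => M → ℂ) := ⟨Subtype.val⟩

/-- The Lie algebra `Γ(TM) = Der(C^∞(M))` of (complex) vector fields on `M`. -/
abbrev VectorField := Derivation ℂ (CInf V M) (CInf V M)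

variable {V M}

namespace CInf

@[ext] theorem ext {f g : CInf V M} (h : ∀ x, f x = g x) : f = g := Subtype.ext (funext h)
@[simp] theorem add_apply (f g : CInf V M) (x : M) : (f + g) x = f x + g x := rfl
@[simp] theorem sub_apply (f g : CInf V M) (x : M) : (f - g) x = f x - g x := rfl
@[simp] theorem neg_apply (f : CInf V M) (x : M) : (-f) x = -f x := rfl
@[simp] theorem mul_apply (f g : CInf V M) (x : M) : (f * g) x = f x * g x := rfl
@[simp] theorem zero_apply (x : M) : (0 : CInf V M) x = 0 := rfl
@[simp] theorem one_apply (x : M) : (1 : CInf V M) x = 1 := rfl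
@[simp] theorem smul_apply (c : ℂ) (f : CInf V M) (x : M) : (c • f) x = c * f x := rfl

/-- Complex conjugation of functions. -/
def conj (f : CInf V M) : CInf V M :=
  ⟨fun x => starRingEnd ℂ (f x), Complex.conjCLE.contDiff.contMDiff.comp f.2⟩

end CInf

/-- A vector field is real if it commutes with complex conjugation of functions, that is, if it
is an ordinary (not complexified) vector field. -/
def VectorField.IsReal (X : VectorField V M) : Prop := ∀ f : CInf V M, X f.conj = (X f).conj

theorem exists_bump [FiniteDimensional ℝ V] [T2Space M] [IsManifold 𝓘(ℝ, V) ∞ M]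
    {U : Set M} {x : M} (hU : U ∈ 𝓝 x) :
    ∃ φ : CInf V M, (∀ᶠ y in 𝓝 x, φ y = 1) ∧ tsupport (φ : M → ℂ) ⊆ U := by
  obtain ⟨f, -, hf⟩ := (SmoothBumpFunction.nhds_basis_tsupport (I := 𝓘(ℝ, V)) x).mem_iff.1 hU
  refine ⟨⟨fun y => (f y : ℂ), Complex.ofRealCLM.contDiff.contMDiff.comp f.contMDiff⟩, ?_, ?_⟩
  · filter_upwards [f.eventuallyEq_one] with y hy
    simp [hy]
  · refine subset_trans (closure_mono ?_) hf
    intro y hy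
    simpa using hy

end Functions

/-! ### Smooth sections and smooth endomorphisms -/

section Real

variable {M : Type*} [TopologicalSpace M] (F : Type*) [NormedAddCommGroup F] [NormedSpace ℂ F]
  (E : M → Type*) [TopologicalSpace (TotalSpace F E)] [∀ x, AddCommGroup (E x)]
  [∀ x, Module ℂ (E x)] [∀ x, TopologicalSpace (E x)] [FiberBundle F E] [VectorBundle ℂ F E]

/-- A complex vector bundle is in particular a real vector bundle. -/
instance realVectorBundle : VectorBundle ℝ F E where
  trivialization_linear' e he := by
    refine ⟨fun b hb => ⟨(Trivialization.linear ℂ e hb).map_add, fun c v => ?_⟩⟩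
    have h2 := (Trivialization.linear ℂ e hb).map_smul (c : ℂ) v
    simpa using h2
  continuousOn_coordChange' e e' he he' := by
    have h := continuousOn_coordChange ℂ e e'
    refine ((ContinuousLinearMap.restrictScalarsL ℂ F F ℝ ℝ).continuous.comp_continuousOn
      h).congr fun b hb => ?_
    ext v
    simp [Trivialization.coordChangeL_apply, hb.1, hb.2]

end Real

section Sections

variable {V : Type*} [NormedAddCommGroup V] [NormedSpace ℝ V]
  {M : Type*} [TopologicalSpace M] [ChartedSpace V M]
  {F : Type*} [NormedAddCommGroup F] [NormedSpace ℂ F]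
  {E : M → Type*} [TopologicalSpace (TotalSpace F E)] [∀ x, AddCommGroup (E x)]
  [∀ x, Module ℂ (E x)] [∀ x, TopologicalSpace (E x)] [FiberBundle F E] [VectorBundle ℂ F E]

theorem coord_add (e : Trivialization F (TotalSpace.proj : TotalSpace F E → M))
    [MemTrivializationAtlas e] {x : M} (hx : x ∈ e.baseSet) (v w : E x) :
    (e ⟨x, v + w⟩).2 = (e ⟨x, v⟩).2 + (e ⟨x, w⟩).2 :=
  (Trivialization.linear ℂ e hx).map_add v w

theorem coord_smul (e : Trivialization F (TotalSpace.proj : TotalSpace F E → M))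
    [MemTrivializationAtlas e] {x : M} (hx : x ∈ e.baseSet) (c : ℂ) (v : E x) :
    (e ⟨x, c • v⟩).2 = c • (e ⟨x, v⟩).2 :=
  (Trivialization.linear ℂ e hx).map_smul c v

variable (V F) in
/-- Smoothness at `x` of a (not necessarily continuous) section `s` of `E`. -/
abbrev SmoothSecAt (s : Π x, E x) (x : M) : Prop :=
  ContMDiffAt 𝓘(ℝ, V) (𝓘(ℝ, V).prod 𝓘(ℝ, F)) ∞ (fun y => TotalSpace.mk' F y (s y)) x

theorem smoothSecAt_congr {s t : Π x, E x} {x : M} (hs : SmoothSecAt V F s x)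
    (h : ∀ᶠ y in 𝓝 x, t y = s y) : SmoothSecAt V F t x :=
  hs.congr_of_eventuallyEq (h.mono fun y hy => by simp [hy])

variable [ContMDiffVectorBundle ∞ F E 𝓘(ℝ, V)]

theorem smoothSecAt_smul {f : M → ℂ} {s : Π x, E x} {x : M}
    (hf : ContMDiffAt 𝓘(ℝ, V) 𝓘(ℝ, ℂ) ∞ f x) (hs : SmoothSecAt V F s x) :
    SmoothSecAt V F (fun y => f y • s y) x := by
  set e := trivializationAt F E x
  have hx : x ∈ e.baseSet := FiberBundle.mem_baseSet_trivializationAt' x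
  unfold SmoothSecAt at hs ⊢
  rw [e.contMDiffAt_section_iff hx] at hs ⊢
  refine (contMDiffAt_smul_complex hf hs).congr_of_eventuallyEq ?_
  filter_upwards [e.open_baseSet.mem_nhds hx] with y hy
  exact coord_smul e hy _ _

variable (V F E) in
/-- The smooth sections of `E`, as a complex subspace of all sections. -/
def secSubmodule : Submodule ℂ (Π x, E x) where
  carrier := {s | ContMDiff 𝓘(ℝ, V) (𝓘(ℝ, V).prod 𝓘(ℝ, F)) ∞ (fun x => TotalSpace.mk' F x (s x))}
  add_mem' hs ht := ContMDiff.add_section hs ht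
  zero_mem' := contMDiff_zeroSection ℝ E
  smul_mem' c _ hs x := smoothSecAt_smul (contMDiffAt_const (c := c)) (hs x)

variable (V F E) in
/-- The space `Γ(E)` of smooth sections of `E`. -/
def Sec : Type _ := secSubmodule V F E

instance : AddCommGroup (Sec V F E) := inferInstanceAs (AddCommGroup (secSubmodule V F E))
instance : Module ℂ (Sec V F E) := inferInstanceAs (Module ℂ (secSubmodule V F E))
instance : CoeFun (Sec V F E) (fun _ => Π x, E x) := ⟨Subtype.val⟩

@[ext] theorem Sec.ext {s t : Sec V F E} (h : ∀ x, s x = t x) : s = t := Subtype.ext (funext h)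

instance : SMul (CInf V M) (Sec V F E) :=
  ⟨fun f s => ⟨fun x => f x • s x, fun x => smoothSecAt_smul (f.2 x) (s.2 x)⟩⟩

namespace Sec

@[simp] theorem add_apply (s t : Sec V F E) (x : M) : (s + t) x = s x + t x := rfl
@[simp] theorem sub_apply (s t : Sec V F E) (x : M) : (s - t) x = s x - t x := rfl
@[simp] theorem neg_apply (s : Sec V F E) (x : M) : (-s) x = -s x := rfl
@[simp] theorem zero_apply (x : M) : (0 : Sec V F E) x = 0 := rfl
@[simp] theorem csmul_apply (c : ℂ) (s : Sec V F E) (x : M) : (c • s) x = c • s x := rfl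
@[simp] theorem smul_apply (f : CInf V M) (s : Sec V F E) (x : M) : (f • s) x = f x • s x := rfl

theorem sum_apply {ι : Type*} (t : Finset ι) (s : ι → Sec V F E) (x : M) :
    (∑ i ∈ t, s i) x = ∑ i ∈ t, s i x := by
  classical
  induction t using Finset.induction_on with
  | empty => simp
  | insert a t ha ih => rw [Finset.sum_insert ha, Finset.sum_insert ha, add_apply, ih]

end Sec

instance : Module (CInf V M) (Sec V F E) where
  one_smul s := by ext x; simp
  mul_smul f g s := by ext x; simp [mul_smul]
  smul_zero f := by ext x; simp
  smul_add f s t := by ext x; simp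
  add_smul f g s := by ext x; simp [add_smul]
  zero_smul s := by ext x; simp

instance : IsScalarTower ℂ (CInf V M) (Sec V F E) :=
  ⟨fun c f s => by ext x; simp [mul_smul]⟩
instance : SMulCommClass ℂ (CInf V M) (Sec V F E) :=
  ⟨fun c f s => by ext x; simp [smul_smul, mul_comm]⟩

theorem symm_expand (e : Trivialization F (TotalSpace.proj : TotalSpace F E → M))
    [MemTrivializationAtlas e] {y : M} (hy : y ∈ e.baseSet) {ι : Type*} [Fintype ι]
    (b : Module.Basis ι ℂ F) (v : E y) :
    v = ∑ j, b.coord j (e ⟨y, v⟩).2 • e.symmₗ ℂ y (b j) := by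
  have h1 : v = e.symmₗ ℂ y (e ⟨y, v⟩).2 := by
    rw [e.symmₗ_apply hy]
    exact (e.symm_apply_apply_mk hy _).symm
  conv_lhs => rw [h1, ← b.sum_repr (e ⟨y, v⟩).2]
  rw [map_sum]
  refine Finset.sum_congr rfl fun j _ => ?_
  rw [map_smul]
  rfl

theorem smoothSecAt_symm (e : Trivialization F (TotalSpace.proj : TotalSpace F E → M))
    [MemTrivializationAtlas e] {x : M} (hx : x ∈ e.baseSet) (v : F) :
    SmoothSecAt V F (fun y => (e.symm y v : E y)) x := by
  unfold SmoothSecAt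
  rw [e.contMDiffAt_section_iff hx]
  refine (contMDiffAt_const (c := v)).congr_of_eventuallyEq ?_
  filter_upwards [e.open_baseSet.mem_nhds hx] with y hy
  rw [e.apply_mk_symm hy]

theorem smoothSecAt_symmₗ (e : Trivialization F (TotalSpace.proj : TotalSpace F E → M))
    [MemTrivializationAtlas e] {x : M} (hx : x ∈ e.baseSet) (v : F) :
    SmoothSecAt V F (fun y => (e.symmₗ ℂ y v : E y)) x :=
  smoothSecAt_congr (smoothSecAt_symm e hx v) <| by
    filter_upwards [e.open_baseSet.mem_nhds hx] with y hy
    rw [e.symmₗ_apply hy]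

variable [FiniteDimensional ℂ F]

theorem smoothSecAt_end_apply (S : Π x, Module.End ℂ (E x)) {x : M}
    (e : Trivialization F (TotalSpace.proj : TotalSpace F E → M)) [MemTrivializationAtlas e]
    (hx : x ∈ e.baseSet)
    (hS : ∀ v : F, ContMDiffAt 𝓘(ℝ, V) 𝓘(ℝ, F) ∞ (fun y => (e ⟨y, S y (e.symm y v)⟩).2) x)
    {s : Π x, E x} (hs : SmoothSecAt V F s x) : SmoothSecAt V F (fun y => S y (s y)) x := by
  unfold SmoothSecAt at hs ⊢
  rw [e.contMDiffAt_section_iff hx] at hs ⊢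
  let b := Module.finBasis ℂ F
  have key : ContMDiffAt 𝓘(ℝ, V) 𝓘(ℝ, F) ∞
     (fun y => ∑ j, (b.coord j).toContinuousLinearMap (e ⟨y, s y⟩).2 •
        (e ⟨y, S y (e.symm y (b j))⟩).2) x := by
    apply ContMDiffAt.sum
    intro j _
    refine contMDiffAt_smul_complex ?_ (hS _)
    exact (((b.coord j).toContinuousLinearMap.contDiff (n := ∞)).restrict_scalars
      ℝ).contMDiff.contMDiffAt.comp x hs
  refine key.congr_of_eventuallyEq ?_
  filter_upwards [e.open_baseSet.mem_nhds hx] with y hy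
  have h3 : ∀ w : E y, (e ⟨y, w⟩).2 = e.linearMapAt ℂ y w := fun w => by
    rw [e.coe_linearMapAt_of_mem hy]
  conv_lhs => rw [symm_expand e hy b (s y)]
  simp only [h3, map_sum, map_smul]
  refine Finset.sum_congr rfl fun j _ => ?_
  rw [e.symmₗ_apply hy]
  rfl

variable (V F E) in
/-- The smooth sections of the bundle `End(E)`: the families `S x ∈ End(E x)` whose matrix in each
local trivialization `e` of `E` is smooth (each column `x ↦ e ∘ S x ∘ e⁻¹ (v)` is smooth). -/
def endSubalgebra : Subalgebra ℂ (Π x, Module.End ℂ (E x)) where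
  carrier := {S | ∀ (e : Trivialization F (TotalSpace.proj : TotalSpace F E → M))
    [MemTrivializationAtlas e] (v : F),
    ContMDiffOn 𝓘(ℝ, V) 𝓘(ℝ, F) ∞ (fun x => (e ⟨x, S x (e.symm x v)⟩).2) e.baseSet}
  add_mem' {S T} hS hT e he v := by
    refine ((hS e v).add (hT e v)).congr fun x hx => ?_
    exact coord_add e hx _ _
  mul_mem' {S T} hS hT e he v := by
    refine (e.contMDiffOn_section_baseSet_iff (s := fun x => S x (T x (e.symm x v)))).1 ?_
    intro x hx
    refine (smoothSecAt_end_apply S e hx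
      (fun w => (hS e w x hx).contMDiffAt (e.open_baseSet.mem_nhds hx)) ?_).contMDiffWithinAt
    exact smoothSecAt_end_apply T e hx
      (fun w => (hT e w x hx).contMDiffAt (e.open_baseSet.mem_nhds hx)) (smoothSecAt_symm e hx v)
  algebraMap_mem' c e he v := by
    refine (e.contMDiffOn_section_baseSet_iff (s := fun x => c • (e.symm x v))).1 ?_
    intro x hx
    exact (smoothSecAt_smul contMDiffAt_const (smoothSecAt_symm e hx v)).contMDiffWithinAt

variable (V F E) in
/-- The algebra `𝔄 = Γ(End(E))` of smooth endomorphisms of the bundle `E`. -/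
def EndSec : Type _ := endSubalgebra V F E

instance : Ring (EndSec V F E) := inferInstanceAs (Ring (endSubalgebra V F E))
instance : Algebra ℂ (EndSec V F E) := inferInstanceAs (Algebra ℂ (endSubalgebra V F E))
instance : CoeFun (EndSec V F E) (fun _ => Π x, Module.End ℂ (E x)) := ⟨Subtype.val⟩

@[ext] theorem EndSec.ext {S T : EndSec V F E} (h : ∀ x v, S x v = T x v) : S = T :=
  Subtype.ext (funext fun x => LinearMap.ext (h x))

theorem EndSec.smooth_apply (S : EndSec V F E) {s : Π x, E x} {x : M}
    (hs : SmoothSecAt V F s x) : SmoothSecAt V F (fun y => S y (s y)) x :=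
  smoothSecAt_end_apply S.1 _ (FiberBundle.mem_baseSet_trivializationAt' (F := F) x)
    (fun w => (S.2 _ w x (FiberBundle.mem_baseSet_trivializationAt' x)).contMDiffAt
      ((Trivialization.open_baseSet _).mem_nhds (FiberBundle.mem_baseSet_trivializationAt' x))) hs

/-- A family of endomorphisms which maps the sections `e.symm v` to smooth sections is smooth. -/
theorem mem_endSubalgebra {S : Π x, Module.End ℂ (E x)}
    (h : ∀ (e : Trivialization F (TotalSpace.proj : TotalSpace F E → M))
      [MemTrivializationAtlas e] (v : F), ∀ x ∈ e.baseSet,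
      SmoothSecAt V F (fun y => S y (e.symm y v)) x) : S ∈ endSubalgebra V F E := by
  intro e he v
  refine (e.contMDiffOn_section_baseSet_iff (s := fun x => S x (e.symm x v))).1 ?_
  intro x hx
  exact (h e v x hx).contMDiffWithinAt

instance : SMul (CInf V M) (EndSec V F E) :=
  ⟨fun f S => ⟨fun x => f x • S x, mem_endSubalgebra fun e _ v x hx =>
    smoothSecAt_smul (f.2 x) (S.smooth_apply (smoothSecAt_symm e hx v))⟩⟩

namespace EndSec

@[simp] theorem add_apply (S T : EndSec V F E) (x : M) : (S + T) x = S x + T x := rfl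
@[simp] theorem sub_apply (S T : EndSec V F E) (x : M) : (S - T) x = S x - T x := rfl
@[simp] theorem neg_apply (S : EndSec V F E) (x : M) : (-S) x = -S x := rfl
@[simp] theorem zero_apply (x : M) : (0 : EndSec V F E) x = 0 := rfl
@[simp] theorem one_apply (x : M) : (1 : EndSec V F E) x = 1 := rfl
@[simp] theorem mul_apply (S T : EndSec V F E) (x : M) : (S * T) x = S x * T x := rfl
@[simp] theorem csmul_apply (c : ℂ) (S : EndSec V F E) (x : M) : (c • S) x = c • S x := rfl
@[simp] theorem smul_apply (f : CInf V M) (S : EndSec V F E) (x : M) :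
    (f • S) x = f x • S x := rfl

end EndSec

instance : Module (CInf V M) (EndSec V F E) where
  one_smul s := by ext x; simp
  mul_smul f g s := by ext x; simp [mul_smul]
  smul_zero f := by ext x; simp
  smul_add f s t := by ext x; simp
  add_smul f g s := by ext x; simp [add_smul]
  zero_smul s := by ext x; simp

/-- `𝔄` as an algebra over `C^∞(M)`, a function `f` being identified with `f • 1`. -/
instance : Algebra (CInf V M) (EndSec V F E) :=
  Algebra.ofModule (fun f S T => by ext x; simp) (fun f S T => by ext x; simp)

instance : IsScalarTower ℂ (CInf V M) (EndSec V F E) :=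
  ⟨fun c f s => by ext x; simp [mul_smul]⟩
instance : SMulCommClass ℂ (CInf V M) (EndSec V F E) :=
  ⟨fun c f s => by ext x; simp [smul_smul, mul_comm]⟩

/-- A smooth endomorphism as a `C^∞(M)`-linear operator on sections. -/
def EndSec.act : EndSec V F E →ₗ[CInf V M] Module.End (CInf V M) (Sec V F E) where
  toFun S :=
    { toFun s := ⟨fun x => S x (s x), fun x => S.smooth_apply (s.2 x)⟩
      map_add' s t := by ext x; exact map_add (S x) _ _
      map_smul' f s := by ext x; exact map_smul (S x) _ _ }
  map_add' S T := rfl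
  map_smul' f S := rfl

@[simp] theorem EndSec.act_apply (S : EndSec V F E) (s : Sec V F E) (x : M) :
    (EndSec.act S s) x = S x (s x) := rfl

end Sections

/-! ### Tensoriality: `C^∞(M)`-linear operators on sections are smooth endomorphisms -/

section Tensorial

variable {V : Type*} [NormedAddCommGroup V] [NormedSpace ℝ V] [FiniteDimensional ℝ V]
  {M : Type*} [TopologicalSpace M] [ChartedSpace V M] [T2Space M] [IsManifold 𝓘(ℝ, V) ∞ M]
  {F : Type*} [NormedAddCommGroup F] [NormedSpace ℂ F]
  {E : M → Type*} [TopologicalSpace (TotalSpace F E)] [∀ x, AddCommGroup (E x)]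
  [∀ x, Module ℂ (E x)] [∀ x, TopologicalSpace (E x)] [FiberBundle F E] [VectorBundle ℂ F E]
  [ContMDiffVectorBundle ∞ F E 𝓘(ℝ, V)]

/-- Multiplying a local section by a smooth function supported in its domain. -/
theorem cut_mem {φ : CInf V M} {U : Set M} (hφ : tsupport (φ : M → ℂ) ⊆ U)
    {s : Π x, E x} (hs : ∀ x ∈ U, SmoothSecAt V F s x) :
    (fun x => φ x • s x) ∈ secSubmodule V F E := by
  intro x
  by_cases hx : x ∈ U
  · exact smoothSecAt_smul (φ.2 x) (hs x hx)
  · have hx' : x ∉ tsupport (φ : M → ℂ) := fun h => hx (hφ h)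
    refine smoothSecAt_congr ((contMDiff_zeroSection ℝ E) x) ?_
    filter_upwards [notMem_tsupport_iff_eventuallyEq.1 hx'] with y hy
    simp [show φ y = 0 from hy]

theorem cut_fun_mem {φ : CInf V M} {U : Set M} (hφ : tsupport (φ : M → ℂ) ⊆ U)
    {f : M → ℂ} (hf : ∀ x ∈ U, ContMDiffAt 𝓘(ℝ, V) 𝓘(ℝ, ℂ) ∞ f x) :
    (fun x => φ x * f x) ∈ smoothSubalgebra V M := by
  intro x
  by_cases hx : x ∈ U
  · exact contMDiffAt_smul_complex (φ.2 x) (hf x hx)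
  · have hx' : x ∉ tsupport (φ : M → ℂ) := fun h => hx (hφ h)
    refine (contMDiffAt_const (c := (0 : ℂ))).congr_of_eventuallyEq ?_
    filter_upwards [notMem_tsupport_iff_eventuallyEq.1 hx'] with y hy
    simp [show φ y = 0 from hy]

theorem exists_extend (x : M) : ∃ L : E x →ₗ[ℂ] Sec V F E, ∀ v, L v x = v := by
  set e := trivializationAt F E x
  have hx : x ∈ e.baseSet := FiberBundle.mem_baseSet_trivializationAt' x
  obtain ⟨φ, h1, hφ⟩ := exists_bump (V := V) (e.open_baseSet.mem_nhds hx)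
  refine ⟨{ toFun v := ⟨fun y => φ y • e.symmₗ ℂ y (e.linearMapAt ℂ x v),
              cut_mem hφ fun y hy => smoothSecAt_symmₗ e hy _⟩
            map_add' v w := by
              ext y
              change φ y • e.symmₗ ℂ y (e.linearMapAt ℂ x (v + w)) =
                φ y • e.symmₗ ℂ y (e.linearMapAt ℂ x v) + φ y • e.symmₗ ℂ y (e.linearMapAt ℂ x w)
              simp
            map_smul' c v := by
              ext y
              change φ y • e.symmₗ ℂ y (e.linearMapAt ℂ x (c • v)) =
                c • φ y • e.symmₗ ℂ y (e.linearMapAt ℂ x v)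
              simp [smul_comm c] }, fun v => ?_⟩
  change φ x • e.symmₗ ℂ x (e.linearMapAt ℂ x v) = v
  rw [h1.self_of_nhds, one_smul, e.symmₗ_linearMapAt hx]

/-- A linear extension of vectors at `x` to global smooth sections. -/
def extend (x : M) : E x →ₗ[ℂ] Sec V F E := (exists_extend x).choose

@[simp] theorem extend_apply (x : M) (v : E x) : (extend x v : Sec V F E) x = v :=
  (exists_extend (V := V) (F := F) x).choose_spec v

variable [FiniteDimensional ℂ F]

theorem smooth_coord (e : Trivialization F (TotalSpace.proj : TotalSpace F E → M))
    [MemTrivializationAtlas e] (ℓ : F →ₗ[ℂ] ℂ) (s : Sec V F E) {x : M} (hx : x ∈ e.baseSet) :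
    ContMDiffAt 𝓘(ℝ, V) 𝓘(ℝ, ℂ) ∞ (fun y => ℓ (e ⟨y, s y⟩).2) x :=
  ((ℓ.toContinuousLinearMap.contDiff (n := ∞)).restrict_scalars
      ℝ).contMDiff.contMDiffAt.comp x ((e.contMDiffAt_section_iff hx).1 (s.2 x))

theorem tensorial_vanish (T : Module.End (CInf V M) (Sec V F E)) {s : Sec V F E} {x : M}
    (hs : s x = 0) : T s x = 0 := by
  set e := trivializationAt F E x
  have hx : x ∈ e.baseSet := FiberBundle.mem_baseSet_trivializationAt' x
  obtain ⟨φ, h1, hφ⟩ := exists_bump (V := V) (e.open_baseSet.mem_nhds hx)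
  let b := Module.finBasis ℂ F
  let f : Fin (Module.finrank ℂ F) → CInf V M := fun j =>
    ⟨fun y => φ y * b.coord j (e ⟨y, s y⟩).2, cut_fun_mem hφ fun y hy => smooth_coord e _ s hy⟩
  let t : Fin (Module.finrank ℂ F) → Sec V F E := fun j =>
    ⟨fun y => φ y • e.symmₗ ℂ y (b j), cut_mem hφ fun y hy => smoothSecAt_symmₗ e hy _⟩
  have key : (φ * φ) • s = ∑ j, f j • t j := by
    ext y
    rw [Sec.sum_apply]
    change (φ y * φ y) • s y =
      ∑ j, (φ y * b.coord j (e ⟨y, s y⟩).2) • φ y • e.symmₗ ℂ y (b j)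
    by_cases hy : y ∈ e.baseSet
    · conv_lhs => rw [symm_expand e hy b (s y)]
      rw [Finset.smul_sum]
      refine Finset.sum_congr rfl fun j _ => ?_
      simp only [smul_smul]
      ring_nf
    · have : φ y = 0 := by
        by_contra h
        exact hy (hφ (subset_tsupport _ h))
      simp [this]
  have h2 := congrArg (fun u : Sec V F E => T u x) key
  simp only [map_smul, map_sum, Sec.sum_apply, Sec.smul_apply] at h2
  have hf : ∀ j, f j x = 0 := fun j => by
    change φ x * b.coord j (e ⟨x, s x⟩).2 = 0
    have : (e ⟨x, s x⟩).2 = e.linearMapAt ℂ x (s x) := by rw [e.coe_linearMapAt_of_mem hx]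
    rw [this, hs]
    simp
  simpa [hf, h1.self_of_nhds] using h2

/-- The smooth endomorphism of `E` defined by a `C^∞(M)`-linear operator on sections. -/
def ofTensorial (T : Module.End (CInf V M) (Sec V F E)) : EndSec V F E :=
  ⟨fun x =>
    { toFun v := T (extend x v) x
      map_add' v w := by simp
      map_smul' c v := by
        have : extend x (c • v) = (algebraMap ℂ (CInf V M) c) • (extend x v : Sec V F E) := by
          rw [map_smul, algebraMap_smul]
        rw [this, map_smul]
        rfl },
    mem_endSubalgebra fun e _ v x hx => by
      obtain ⟨φ, h1, hφ⟩ := exists_bump (V := V) (e.open_baseSet.mem_nhds hx)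
      let t : Sec V F E := ⟨fun y => φ y • e.symm y v, cut_mem hφ fun y hy => smoothSecAt_symm e hy _⟩
      refine smoothSecAt_congr ((T t).2 x) ?_
      filter_upwards [h1] with y hy
      have h3 : T (extend y (e.symm y v) - t) y = 0 := tensorial_vanish T (by
        have : t y = e.symm y v := by
          change φ y • e.symm y v = _
          rw [hy, one_smul]
        simp [this])
      rw [map_sub, Sec.sub_apply, sub_eq_zero] at h3
      exact h3⟩

theorem ofTensorial_apply (T : Module.End (CInf V M) (Sec V F E)) (s : Sec V F E) (x : M) :
    ofTensorial T x (s x) = T s x := by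
  have h3 : T (extend x (s x) - s) x = 0 := tensorial_vanish T (by simp)
  rw [map_sub, Sec.sub_apply, sub_eq_zero] at h3
  exact h3

@[simp] theorem act_ofTensorial (T : Module.End (CInf V M) (Sec V F E)) :
    EndSec.act (ofTensorial T) = T := by
  ext s x
  exact ofTensorial_apply T s x

theorem EndSec.ext_act {S T : EndSec V F E}
    (h : ∀ s x, EndSec.act S s x = EndSec.act T s x) : S = T := by
  ext x v
  simpa using h (extend x v) x

end Tensorial

/-! ### Traces, derivations of `𝔄`, and the exact sequence of `Der(𝔄)` -/

section Derivations

variable {V : Type*} [NormedAddCommGroup V] [NormedSpace ℝ V]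
  {M : Type*} [TopologicalSpace M] [ChartedSpace V M]
  {F : Type*} [NormedAddCommGroup F] [NormedSpace ℂ F]
  {E : M → Type*} [TopologicalSpace (TotalSpace F E)] [∀ x, AddCommGroup (E x)]
  [∀ x, Module ℂ (E x)] [∀ x, TopologicalSpace (E x)] [FiberBundle F E] [VectorBundle ℂ F E]
  [ContMDiffVectorBundle ∞ F E 𝓘(ℝ, V)] [FiniteDimensional ℂ F]

theorem trace_eq (e : Trivialization F (TotalSpace.proj : TotalSpace F E → M))
    [MemTrivializationAtlas e] {y : M} (hy : y ∈ e.baseSet) (A : Module.End ℂ (E y)) :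
    LinearMap.trace ℂ (E y) A = ∑ j, (Module.finBasis ℂ F).coord j
      (e ⟨y, A (e.symm y (Module.finBasis ℂ F j))⟩).2 := by
  let b := (Module.finBasis ℂ F).map (e.linearEquivAt ℂ y hy).symm
  rw [LinearMap.trace_eq_matrix_trace ℂ b, Matrix.trace]
  refine Finset.sum_congr rfl fun j _ => ?_
  simp [LinearMap.toMatrix_apply, b]

/-- The trace `Tr : 𝔄 → C^∞(M)`, taken in each fiber. -/
def EndSec.tr : EndSec V F E →ₗ[CInf V M] CInf V M where
  toFun S := ⟨fun x => LinearMap.trace ℂ (E x) (S x), fun x => by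
    set e := trivializationAt F E x
    have hx : x ∈ e.baseSet := FiberBundle.mem_baseSet_trivializationAt' x
    have key : ContMDiffAt 𝓘(ℝ, V) 𝓘(ℝ, ℂ) ∞ (fun y => ∑ j, (Module.finBasis ℂ F).coord j
        (e ⟨y, S y (e.symm y (Module.finBasis ℂ F j))⟩).2) x := by
      apply ContMDiffAt.sum
      intro j _
      exact ((((Module.finBasis ℂ F).coord j).toContinuousLinearMap.contDiff
        (n := ∞)).restrict_scalars ℝ).contMDiff.contMDiffAt.comp x
        ((S.2 e _ x hx).contMDiffAt (e.open_baseSet.mem_nhds hx))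
    refine key.congr_of_eventuallyEq ?_
    filter_upwards [e.open_baseSet.mem_nhds hx] with y hy
    exact trace_eq e hy _⟩
  map_add' S T := by ext x; exact map_add (LinearMap.trace ℂ (E x)) _ _
  map_smul' f S := by ext x; exact map_smul (LinearMap.trace ℂ (E x)) _ _

theorem EndSec.tr_apply (S : EndSec V F E) (x : M) :
    EndSec.tr S x = LinearMap.trace ℂ (E x) (S x) := rfl

/-- The traceless part `γ - (1/n) Tr(γ) 1` of `γ ∈ 𝔄`, where `n` is the rank of `E`. -/
def EndSec.traceless : EndSec V F E →ₗ[CInf V M] EndSec V F E where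
  toFun γ := γ - ((Module.finrank ℂ F : ℂ)⁻¹ • EndSec.tr γ) • (1 : EndSec V F E)
  map_add' S T := by rw [map_add, smul_add, add_smul]; abel
  map_smul' f S := by
    rw [map_smul, RingHom.id_apply, smul_sub, smul_smul, smul_eq_mul, mul_smul_comm]

variable (V F E) in
/-- The derivations of the complex algebra `𝔄`, as a `C^∞(M)`-module. -/
def Der : Submodule (CInf V M) (Module.End ℂ (EndSec V F E)) where
  carrier := {D | ∀ S T, D (S * T) = D S * T + S * D T}
  add_mem' {D D'} h h' S T := by
    simp only [LinearMap.add_apply, h S T, h' S T]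
    noncomm_ring
  zero_mem' S T := by simp
  smul_mem' f D h S T := by
    simp only [LinearMap.smul_apply, h S T, smul_add, smul_mul_assoc, mul_smul_comm]

theorem Der.leibniz (D : Der V F E) (S T : EndSec V F E) :
    D.1 (S * T) = D.1 S * T + S * D.1 T := D.2 S T

@[ext] theorem Der.ext {D D' : Der V F E} (h : ∀ S, D.1 S = D'.1 S) : D = D' :=
  Subtype.ext (LinearMap.ext h)

/-- The Lie bracket of derivations is the commutator. -/
instance : Bracket (Der V F E) (Der V F E) :=
  ⟨fun D D' => ⟨D.1 * D'.1 - D'.1 * D.1, fun S T => by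
    simp only [LinearMap.sub_apply, Module.End.mul_apply, Der.leibniz, map_add]
    noncomm_ring⟩⟩

theorem Der.bracket_apply (D D' : Der V F E) (S : EndSec V F E) :
    (⁅D, D'⁆ : Der V F E).1 S = D.1 (D'.1 S) - D'.1 (D.1 S) := rfl

instance : LieRing (Der V F E) where
  add_lie D D' D'' := by
    ext1 S
    simp only [Der.bracket_apply, Submodule.coe_add, LinearMap.add_apply, map_add]
    abel
  lie_add D D' D'' := by
    ext1 S
    simp only [Der.bracket_apply, Submodule.coe_add, LinearMap.add_apply, map_add]
    abel
  lie_self D := by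
    ext1 S
    simp [Der.bracket_apply]
  leibniz_lie D D' D'' := by
    ext1 S
    simp only [Der.bracket_apply, Submodule.coe_add, LinearMap.add_apply, map_sub]
    abel

/-- The map `γ ↦ ad_γ = [γ, ·]` from `𝔄` to `Der(𝔄)`. -/
def ad : EndSec V F E →ₗ[CInf V M] Der V F E where
  toFun γ := ⟨LinearMap.mulLeft ℂ γ - LinearMap.mulRight ℂ γ, fun S T => by
    simp only [LinearMap.sub_apply, LinearMap.mulLeft_apply, LinearMap.mulRight_apply]
    noncomm_ring⟩
  map_add' γ γ' := by
    ext1 S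
    simp only [Submodule.coe_add, LinearMap.add_apply, LinearMap.sub_apply,
      LinearMap.mulLeft_apply, LinearMap.mulRight_apply]
    noncomm_ring
  map_smul' f γ := by
    ext1 S
    simp [smul_sub]

theorem ad_apply (γ S : EndSec V F E) : (ad γ).1 S = γ * S - S * γ := rfl

variable (V F E) in
/-- The inner derivations of `𝔄`, as a `C^∞(M)`-submodule of `Der(𝔄)`. -/
def Inn : Submodule (CInf V M) (Der V F E) := LinearMap.range ad

/-- `ad`, as a map onto the inner derivations. -/
def adInn : EndSec V F E →ₗ[CInf V M] Inn V F E := LinearMap.rangeRestrict ad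

theorem lie_ad (γ γ' : EndSec V F E) : ⁅ad γ, ad γ'⁆ = ad (γ * γ' - γ' * γ) := by
  ext1 S
  simp only [Der.bracket_apply, ad_apply]
  noncomm_ring

/-- The inner derivations form a Lie subalgebra. -/
instance : Bracket (Inn V F E) (Inn V F E) :=
  ⟨fun δ δ' => ⟨⁅δ.1, δ'.1⁆, by
    obtain ⟨γ, hγ⟩ := δ.2
    obtain ⟨γ', hγ'⟩ := δ'.2
    exact ⟨γ * γ' - γ' * γ, by rw [← hγ, ← hγ', lie_ad]⟩⟩⟩

/-- The form `iθ : Int(𝔄) → 𝔄`, which maps `ad_γ` to `γ - (1/n) Tr(γ) 1`. -/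
def iTheta (δ : Inn V F E) : EndSec V F E := EndSec.traceless δ.2.choose

variable [FiniteDimensional ℝ V] [T2Space M] [IsManifold 𝓘(ℝ, V) ∞ M] [Nontrivial F]

theorem exists_dual (x : M) : ∃ (s : Sec V F E) (ℓ : Sec V F E →ₗ[CInf V M] CInf V M),
    ∀ᶠ y in 𝓝 x, ℓ s y = 1 := by
  set e := trivializationAt F E x
  have hx : x ∈ e.baseSet := FiberBundle.mem_baseSet_trivializationAt' x
  obtain ⟨φ, h1, hφ⟩ := exists_bump (V := V) (e.open_baseSet.mem_nhds hx)
  obtain ⟨v, hv⟩ := exists_ne (0 : F)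
  obtain ⟨l, hl⟩ := Module.Projective.exists_dual_eq_one ℂ hv
  refine ⟨⟨fun y => φ y • e.symmₗ ℂ y v, cut_mem hφ fun y hy => smoothSecAt_symmₗ e hy _⟩,
    { toFun s := ⟨fun y => φ y * l (e ⟨y, s y⟩).2, cut_fun_mem hφ fun y hy => smooth_coord e _ s hy⟩
      map_add' s t := ?_
      map_smul' f s := ?_ }, ?_⟩
  · ext y
    change φ y * l (e ⟨y, s y + t y⟩).2 = φ y * l (e ⟨y, s y⟩).2 + φ y * l (e ⟨y, t y⟩).2
    by_cases hy : y ∈ e.baseSet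
    · rw [coord_add e hy, map_add, mul_add]
    · simp [show φ y = 0 from by_contra fun h => hy (hφ (subset_tsupport _ h))]
  · ext y
    change φ y * l (e ⟨y, f y • s y⟩).2 = f y * (φ y * l (e ⟨y, s y⟩).2)
    by_cases hy : y ∈ e.baseSet
    · rw [coord_smul e hy, map_smul, smul_eq_mul]
      ring
    · simp [show φ y = 0 from by_contra fun h => hy (hφ (subset_tsupport _ h))]
  · filter_upwards [h1, e.open_baseSet.mem_nhds hx] with y h1 hy
    change φ y * l (e ⟨y, φ y • e.symmₗ ℂ y v⟩).2 = 1
    rw [h1, one_smul, one_mul, e.symmₗ_apply hy, e.apply_mk_symm hy, hl]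

/-- The endomorphism `w ↦ ℓ(w) v`. -/
def rankOne (v : Sec V F E) (ℓ : Sec V F E →ₗ[CInf V M] CInf V M) : EndSec V F E :=
  ofTensorial (LinearMap.smulRight ℓ v)

theorem rankOne_apply (v : Sec V F E) (ℓ : Sec V F E →ₗ[CInf V M] CInf V M) (w : Sec V F E)
    (x : M) : rankOne v ℓ x (w x) = ℓ w x • v x := ofTensorial_apply _ _ _

theorem scalar_of_commute {x : M} {z : Module.End ℂ (E x)}
    (h : ∀ S : EndSec V F E, z * S x = S x * z) : ∃ c : ℂ, z = c • 1 := by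
  obtain ⟨s, ℓ, hs⟩ := exists_dual (V := V) (F := F) (E := E) x
  refine ⟨ℓ (extend x (z (s x))) x, LinearMap.ext fun v => ?_⟩
  have h1 := LinearMap.congr_fun (h (rankOne (extend x v) ℓ)) (s x)
  have h2 := rankOne_apply (extend x v) ℓ (extend x (z (s x))) x
  rw [extend_apply, extend_apply] at h2
  rw [Module.End.mul_apply, Module.End.mul_apply, rankOne_apply, extend_apply, h2,
    hs.self_of_nhds, one_smul] at h1
  simpa using h1

theorem finrank_fiber (x : M) : Module.finrank ℂ (E x) = Module.finrank ℂ F :=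
  ((trivializationAt F E x).linearEquivAt ℂ x
    (FiberBundle.mem_baseSet_trivializationAt' x)).finrank_eq

theorem traceless_apply_eq {S T : EndSec V F E} {x : M} {c : ℂ} (h : S x - T x = c • 1) :
    EndSec.traceless S x = EndSec.traceless T x := by
  have hn : (Module.finrank ℂ F : ℂ) ≠ 0 := by
    exact_mod_cast Module.finrank_pos.ne'
  have h1 : S x = T x + c • 1 := by rw [← h]; abel
  have : Module.Finite ℂ (E x) := Module.Finite.equiv ((trivializationAt F E x).linearEquivAt ℂ x
    (FiberBundle.mem_baseSet_trivializationAt' x)).symm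
  change S x - ((Module.finrank ℂ F : ℂ)⁻¹ * LinearMap.trace ℂ (E x) (S x)) • 1 =
    T x - ((Module.finrank ℂ F : ℂ)⁻¹ * LinearMap.trace ℂ (E x) (T x)) • 1
  rw [h1, map_add, map_smul, LinearMap.trace_one, finrank_fiber (F := F)]
  have : (Module.finrank ℂ F : ℂ)⁻¹ * (LinearMap.trace ℂ (E x) (T x) + c • (Module.finrank ℂ F : ℂ))
      = (Module.finrank ℂ F : ℂ)⁻¹ * LinearMap.trace ℂ (E x) (T x) + c := by
    rw [smul_eq_mul]
    field_simp
  rw [this, add_smul]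
  abel

theorem iTheta_spec (δ : Inn V F E) (γ : EndSec V F E) (h : ad γ = δ.1) :
    iTheta δ = γ - ((Module.finrank ℂ F : ℂ)⁻¹ • EndSec.tr γ) • (1 : EndSec V F E) := by
  have h0 : ad (δ.2.choose) = ad γ := δ.2.choose_spec.trans h.symm
  change EndSec.traceless δ.2.choose = EndSec.traceless γ
  refine Subtype.ext (funext fun x => ?_)
  obtain ⟨c, hc⟩ := scalar_of_commute (V := V) (F := F) (z := (δ.2.choose : EndSec V F E) x - γ x)
    (fun S => by
      have h1 := congrArg (fun D : Der V F E => D.1 S x) h0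
      simp only [ad_apply, EndSec.sub_apply, EndSec.mul_apply] at h1
      rw [sub_mul, mul_sub, sub_eq_sub_iff_sub_eq_sub]
      exact h1)
  exact traceless_apply_eq hc

/-- The center of `𝔄` is `C^∞(M)`. -/
theorem eq_tr_of_central {z : EndSec V F E} (h : ∀ S, z * S = S * z) :
    z = ((Module.finrank ℂ F : ℂ)⁻¹ • EndSec.tr z) • (1 : EndSec V F E) := by
  refine Subtype.ext (funext fun x => ?_)
  obtain ⟨c, hc⟩ := scalar_of_commute (V := V) (F := F) (z := z x)
    (fun S => congrArg (fun T : EndSec V F E => T x) (h S))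
  have := traceless_apply_eq (S := z) (T := 0) (x := x) (c := c) (by simpa using hc)
  rw [map_zero] at this
  exact sub_eq_zero.1 this

theorem Der.apply_smul_one (D : Der V F E) (f : CInf V M) :
    D.1 (f • 1) = ((Module.finrank ℂ F : ℂ)⁻¹ • EndSec.tr (D.1 (f • 1))) • (1 : EndSec V F E) := by
  apply eq_tr_of_central
  intro S
  have h1 := Der.leibniz D (f • 1) S
  have h2 := Der.leibniz D S (f • 1)
  have h3 : (f • (1 : EndSec V F E)) * S = S * (f • 1) := by simp
  rw [h3, h2] at h1
  have h4 : D.1 S * (f • (1 : EndSec V F E)) = (f • 1) * D.1 S := by simp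
  rw [h4, add_comm] at h1
  exact (add_right_cancel h1).symm

theorem smul_one_injective {f g : CInf V M} (h : f • (1 : EndSec V F E) = g • 1) : f = g := by
  ext x
  obtain ⟨s, ℓ, hs⟩ := exists_dual (V := V) (F := F) (E := E) x
  have h1 : f • s = g • s := by
    ext y
    have := congrArg (fun T : EndSec V F E => EndSec.act T s y) h
    simpa using this
  have h2 := congrArg (fun u => ℓ u x) h1
  simpa [hs.self_of_nhds] using h2

theorem smul_one_mul_smul_one (f g : CInf V M) :
    (f • (1 : EndSec V F E)) * (g • 1) = (f * g) • 1 := by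
  rw [smul_mul_smul_comm, one_mul]

theorem smul_one_mul (f : CInf V M) (S : EndSec V F E) : (f • (1 : EndSec V F E)) * S = f • S := by
  rw [smul_mul_assoc, one_mul]

/-- The function `ρ(D)(f)`, where `D (f • 1) = ρ(D)(f) • 1`. -/
def rhoAux (D : Der V F E) (f : CInf V M) : CInf V M :=
  (Module.finrank ℂ F : ℂ)⁻¹ • EndSec.tr (D.1 (f • 1))

theorem rhoAux_spec (D : Der V F E) (f : CInf V M) :
    (rhoAux D f) • (1 : EndSec V F E) = D.1 (f • 1) := (Der.apply_smul_one D f).symm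

/-- The restriction map `ρ : Der(𝔄) → Der(C^∞(M)) = Γ(TM)`: the vector field `ρ(D)` is determined
by `D (f • 1) = ρ(D)(f) • 1`, see `rho_spec`. -/
def rho : Der V F E →ₗ[CInf V M] VectorField V M where
  toFun D := Derivation.mk'
    { toFun := rhoAux D
      map_add' f g := by
        apply smul_one_injective (E := E) (F := F)
        simp only [rhoAux_spec, add_smul, map_add]
      map_smul' c f := by
        apply smul_one_injective (E := E) (F := F)
        simp only [rhoAux_spec, smul_assoc, map_smul, RingHom.id_apply] }
    (fun f g => by
      apply smul_one_injective (E := E) (F := F)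
      simp only [LinearMap.coe_mk, AddHom.coe_mk, smul_eq_mul, add_smul,
        ← smul_one_mul_smul_one, rhoAux_spec, Der.leibniz]
      rw [add_comm, smul_one_mul, smul_one_mul, mul_smul_comm, mul_one])
  map_add' D D' := by
    refine Derivation.ext fun f => smul_one_injective (E := E) (F := F) ?_
    change rhoAux (D + D') f • (1 : EndSec V F E) = (rhoAux D f + rhoAux D' f) • 1
    rw [add_smul, rhoAux_spec, rhoAux_spec, rhoAux_spec]
    rfl
  map_smul' h D := by
    refine Derivation.ext fun f => smul_one_injective (E := E) (F := F) ?_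
    change rhoAux (h • D) f • (1 : EndSec V F E) = (h * rhoAux D f) • 1
    rw [mul_smul, rhoAux_spec, rhoAux_spec]
    rfl

theorem rho_spec (D : Der V F E) (f : CInf V M) :
    D.1 (f • 1) = (rho D f) • (1 : EndSec V F E) := (rhoAux_spec D f).symm

end Derivations

/-! ### Derivations of `𝔄` which vanish on the center are inner -/

section Inner

variable {V : Type*} [NormedAddCommGroup V] [NormedSpace ℝ V] [FiniteDimensional ℝ V]
  {M : Type*} [TopologicalSpace M] [ChartedSpace V M] [T2Space M] [IsManifold 𝓘(ℝ, V) ∞ M]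
  {F : Type*} [NormedAddCommGroup F] [NormedSpace ℂ F] [FiniteDimensional ℂ F] [Nontrivial F]
  {E : M → Type*} [TopologicalSpace (TotalSpace F E)] [∀ x, AddCommGroup (E x)]
  [∀ x, Module ℂ (E x)] [∀ x, TopologicalSpace (E x)] [FiberBundle F E] [VectorBundle ℂ F E]
  [ContMDiffVectorBundle ∞ F E 𝓘(ℝ, V)]

theorem Der.map_smul_of_rho_eq_zero {δ : Der V F E} (h : rho δ = 0) (f : CInf V M)
    (S : EndSec V F E) : δ.1 (f • S) = f • δ.1 S := by
  rw [← smul_one_mul f S, Der.leibniz, rho_spec, h, smul_one_mul]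
  simp

theorem exists_local_inner {δ : Der V F E} (h : rho δ = 0) (x : M) :
    ∃ γ : EndSec V F E, ∀ᶠ y in 𝓝 x, ∀ S : EndSec V F E,
      γ y * S y - S y * γ y = δ.1 S y := by
  obtain ⟨s, ℓ, hs⟩ := exists_dual (V := V) (F := F) (E := E) x
  have radd : ∀ v w : Sec V F E, rankOne (v + w) ℓ = rankOne v ℓ + rankOne w ℓ := fun v w =>
    EndSec.ext_act fun u y => by simp [rankOne]
  have rsmul : ∀ (f : CInf V M) (v : Sec V F E), rankOne (f • v) ℓ = f • rankOne v ℓ := fun f v =>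
    EndSec.ext_act fun u y => by simp [rankOne, smul_smul, mul_comm]
  have rmul : ∀ (S : EndSec V F E) (v : Sec V F E),
      rankOne (EndSec.act S v) ℓ = S * rankOne v ℓ := fun S v =>
    EndSec.ext_act fun u y => by
      simp only [EndSec.act_apply, rankOne_apply, EndSec.mul_apply, Module.End.mul_apply, map_smul]
  let T : Module.End (CInf V M) (Sec V F E) :=
    { toFun v := EndSec.act (δ.1 (rankOne v ℓ)) s
      map_add' v w := by rw [radd, map_add, map_add, LinearMap.add_apply]
      map_smul' f v := by
        rw [rsmul, Der.map_smul_of_rho_eq_zero h, map_smul, LinearMap.smul_apply,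
          RingHom.id_apply] }
  have hT : ∀ v y, ofTensorial T y (v y) = δ.1 (rankOne v ℓ) y (s y) := fun v y =>
    ofTensorial_apply T v y
  refine ⟨ofTensorial T, hs.mono fun y hy S => LinearMap.ext fun v => ?_⟩
  have h1 := hT (EndSec.act S (extend y v)) y
  have h2 := hT (extend y v) y
  rw [rmul, Der.leibniz, EndSec.act_apply, extend_apply] at h1
  rw [extend_apply] at h2
  simp only [EndSec.add_apply, EndSec.mul_apply, LinearMap.add_apply, Module.End.mul_apply,
    rankOne_apply, extend_apply, hy, one_smul] at h1
  simp only [LinearMap.sub_apply, Module.End.mul_apply, h1, h2]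
  abel

/-- A derivation of `𝔄` which vanishes on the center `C^∞(M)` is inner. -/
theorem mem_Inn_of_rho_eq_zero {δ : Der V F E} (h : rho δ = 0) : δ ∈ Inn V F E := by
  choose γ hγ using exists_local_inner h
  have key : ∀ x, ∀ᶠ y in 𝓝 x,
      EndSec.traceless (γ y) y = EndSec.traceless (γ x) y := fun x => by
    filter_upwards [hγ x] with y hy
    obtain ⟨c, hc⟩ := scalar_of_commute (V := V) (F := F) (z := γ y y - γ x y) (fun S => by
      have h1 := (hγ y).self_of_nhds S
      rw [← hy S] at h1
      rw [sub_mul, mul_sub, sub_eq_sub_iff_sub_eq_sub]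
      exact h1)
    exact traceless_apply_eq hc
  let Γ : EndSec V F E := ⟨fun y => EndSec.traceless (γ y) y, mem_endSubalgebra fun e _ v x hx => by
    refine smoothSecAt_congr
      ((EndSec.traceless (γ x)).smooth_apply (smoothSecAt_symm e hx v)) ?_
    filter_upwards [key x] with y hy
    rw [hy]⟩
  refine ⟨Γ, Der.ext fun S => Subtype.ext (funext fun y => ?_)⟩
  rw [← (hγ y).self_of_nhds S]
  change (γ y y - ((Module.finrank ℂ F : ℂ)⁻¹ • EndSec.tr (γ y)) y • (1 : Module.End ℂ (E y))) * S y
    - S y * (γ y y - ((Module.finrank ℂ F : ℂ)⁻¹ • EndSec.tr (γ y)) y • 1) = _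
  rw [sub_mul, mul_sub, smul_mul_assoc, mul_smul_comm, one_mul, mul_one]
  abel

end Inner

/-! ### The Atiyah algebra, connections, and the map `D°` -/

section Atiyah

variable {V : Type*} [NormedAddCommGroup V] [NormedSpace ℝ V]
  {M : Type*} [TopologicalSpace M] [ChartedSpace V M]
  {F : Type*} [NormedAddCommGroup F] [NormedSpace ℂ F]
  {E : M → Type*} [TopologicalSpace (TotalSpace F E)] [∀ x, AddCommGroup (E x)]
  [∀ x, Module ℂ (E x)] [∀ x, TopologicalSpace (E x)] [FiberBundle F E] [VectorBundle ℂ F E]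
  [ContMDiffVectorBundle ∞ F E 𝓘(ℝ, V)]

/-- The operator `T` on `Γ(E)` is a first-order differential operator with symbol `Id_E ⊗ X`:
its commutator with the multiplication by `f` is the multiplication by `X f`. -/
def HasSymbol (T : Module.End ℂ (Sec V F E)) (X : VectorField V M) : Prop :=
  ∀ (f : CInf V M) (s : Sec V F E), T (f • s) = f • T s + X f • s

variable (V F E) in
/-- The Atiyah algebra `𝒜(E)`: the first-order differential operators on `E` whose symbol is
`Id_E ⊗ X` for a vector field `X` on `M`. -/
def Atiyah : Submodule (CInf V M) (Module.End ℂ (Sec V F E)) where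
  carrier := {T | ∃ X : VectorField V M, HasSymbol T X}
  add_mem' {T T'} := by
    rintro ⟨X, hX⟩ ⟨X', hX'⟩
    refine ⟨X + X', fun f s => ?_⟩
    simp only [LinearMap.add_apply, hX f s, hX' f s, Derivation.add_apply, add_smul, smul_add]
    abel
  zero_mem' := ⟨0, fun f s => by simp⟩
  smul_mem' g T := by
    rintro ⟨X, hX⟩
    refine ⟨g • X, fun f s => ?_⟩
    simp only [LinearMap.smul_apply, hX f s, Derivation.smul_apply, smul_add, smul_smul,
      smul_eq_mul, mul_comm g f]

theorem HasSymbol.lie {T T' : Module.End ℂ (Sec V F E)} {X X' : VectorField V M}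
    (h : HasSymbol T X) (h' : HasSymbol T' X') : HasSymbol (T * T' - T' * T) ⁅X, X'⁆ := by
  intro f s
  simp only [LinearMap.sub_apply, Module.End.mul_apply, h f, h' f, h (X' f), h' (X f), map_add,
    Derivation.commutator_apply, smul_sub, sub_smul]
  abel

@[ext] theorem Atiyah.ext {T T' : Atiyah V F E} (h : ∀ s, T.1 s = T'.1 s) : T = T' :=
  Subtype.ext (LinearMap.ext h)

/-- The Lie bracket of `𝒜(E)` is the commutator. -/
instance : Bracket (Atiyah V F E) (Atiyah V F E) :=
  ⟨fun T T' => ⟨T.1 * T'.1 - T'.1 * T.1, by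
    obtain ⟨X, hX⟩ := T.2
    obtain ⟨X', hX'⟩ := T'.2
    exact ⟨⁅X, X'⁆, hX.lie hX'⟩⟩⟩

theorem Atiyah.bracket_apply (T T' : Atiyah V F E) (s : Sec V F E) :
    (⁅T, T'⁆ : Atiyah V F E).1 s = T.1 (T'.1 s) - T'.1 (T.1 s) := rfl

instance : LieRing (Atiyah V F E) where
  add_lie T T' T'' := by
    ext1 s
    simp only [Atiyah.bracket_apply, Submodule.coe_add, LinearMap.add_apply, map_add]
    abel
  lie_add T T' T'' := by
    ext1 s
    simp only [Atiyah.bracket_apply, Submodule.coe_add, LinearMap.add_apply, map_add]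
    abel
  lie_self T := by
    ext1 s
    simp [Atiyah.bracket_apply]
  leibniz_lie T T' T'' := by
    ext1 s
    simp only [Atiyah.bracket_apply, Submodule.coe_add, LinearMap.add_apply, map_sub]
    abel

variable (V F E) in
/-- A connection on `E`: a `C^∞(M)`-linear map `X ↦ ∇_X` from the vector fields to the operators
on `Γ(E)` with the Leibniz rule `∇_X (f s) = f ∇_X s + (X f) s`. -/
structure Connection where
  /-- the operator `∇_X` -/
  toFun : VectorField V M →ₗ[CInf V M] Module.End ℂ (Sec V F E)
  leibniz : ∀ X, HasSymbol (toFun X) X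

/-- The covariant derivative `∇_X` as an element of `𝒜(E)`. -/
def Connection.cov (nabla : Connection V F E) (X : VectorField V M) : Atiyah V F E :=
  ⟨nabla.toFun X, X, nabla.leibniz X⟩

variable (V F E) in
/-- An `SU(n)`-structure on the complex vector bundle `E` of rank `n`: a smooth hermitian metric
`h` (antilinear in the first variable), and a trivialization of `⋀ⁿ E` compatible with it, that
is, a smooth complex volume form `vol` with values of modulus `1` on the orthonormal frames. -/
structure SUStructure where
  /-- the hermitian metric -/
  h : ∀ x, E x →ₗ⋆[ℂ] E x →ₗ[ℂ] ℂ
  h_symm : ∀ x u v, starRingEnd ℂ (h x u v) = h x v u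
  h_pos : ∀ x v, v ≠ 0 → 0 < (h x v v).re
  h_smooth : ∀ s t : Sec V F E, (fun x => h x (s x) (t x)) ∈ smoothSubalgebra V M
  /-- the complex volume form -/
  vol : ∀ x, E x [⋀^Fin (Module.finrank ℂ F)]→ₗ[ℂ] ℂ
  vol_smooth : ∀ s : Fin (Module.finrank ℂ F) → Sec V F E,
    (fun x => vol x (fun i => s i x)) ∈ smoothSubalgebra V M
  vol_norm : ∀ x (v : Fin (Module.finrank ℂ F) → E x),
    (∀ i j, h x (v i) (v j) = if i = j then 1 else 0) → ‖vol x v‖ = 1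

/-- The smooth function `⟨s, t⟩`. -/
def SUStructure.pairing (σ : SUStructure V F E) (s t : Sec V F E) : CInf V M :=
  ⟨fun x => σ.h x (s x) (t x), σ.h_smooth s t⟩

/-- The smooth function `vol(s₁, …, sₙ)`. -/
def SUStructure.volume (σ : SUStructure V F E) (s : Fin (Module.finrank ℂ F) → Sec V F E) :
    CInf V M :=
  ⟨fun x => σ.vol x (fun i => s i x), σ.vol_smooth s⟩

/-- An `SU(n)`-connection: a connection for which the hermitian metric and the trivialization of
`⋀ⁿ E` are covariantly constant. -/
structure SUConnection (σ : SUStructure V F E) extends Connection V F E where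
  hermitian : ∀ X : VectorField V M, X.IsReal → ∀ s t : Sec V F E,
    X (σ.pairing s t) = σ.pairing (toFun X s) t + σ.pairing s (toFun X t)
  unimodular : ∀ (X : VectorField V M) (s : Fin (Module.finrank ℂ F) → Sec V F E),
    X (σ.volume s) = ∑ i, σ.volume (Function.update s i (toFun X (s i)))

variable [FiniteDimensional ℂ F]

/-- The inclusion `i : 𝔄 → 𝒜(E)`. -/
def incl : EndSec V F E →ₗ[CInf V M] Atiyah V F E where
  toFun S := ⟨(EndSec.act S).restrictScalars ℂ, 0, fun f s => by simp⟩
  map_add' S T := rfl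
  map_smul' f S := rfl

@[simp] theorem incl_apply (S : EndSec V F E) (s : Sec V F E) :
    (incl S).1 s = EndSec.act S s := rfl

variable (V F E) in
/-- The map `f ↦ f • 1` from `C^∞(M)` to `𝔄`. -/
def scalarEnd : CInf V M →ₗ[CInf V M] EndSec V F E := Algebra.linearMap (CInf V M) (EndSec V F E)

variable (V F E) in
/-- The map `C^∞(M) → 𝒜(E)`, which maps `f` to the multiplication by `f`. -/
def scalarAtiyah : CInf V M →ₗ[CInf V M] Atiyah V F E := incl ∘ₗ scalarEnd V F E

variable [FiniteDimensional ℝ V] [T2Space M] [IsManifold 𝓘(ℝ, V) ∞ M]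

/-- The commutator `[T, S]` of operators on `Γ(E)`, as an element of `𝔄`. -/
def commEnd (T : Atiyah V F E) (S : EndSec V F E) : EndSec V F E :=
  ofTensorial
    { toFun s := T.1 (EndSec.act S s) - EndSec.act S (T.1 s)
      map_add' s t := by
        simp only [map_add]
        abel
      map_smul' f s := by
        obtain ⟨X, hX⟩ := T.2
        simp only [map_smul, hX f, map_add, RingHom.id_apply, smul_sub]
        abel }

theorem act_commEnd (T : Atiyah V F E) (S : EndSec V F E) (s : Sec V F E) :
    EndSec.act (commEnd T S) s = T.1 (EndSec.act S s) - EndSec.act S (T.1 s) := by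
  rw [commEnd, act_ofTensorial]
  rfl

theorem act_mul (S T : EndSec V F E) (s : Sec V F E) :
    EndSec.act (S * T) s = EndSec.act S (EndSec.act T s) := rfl

theorem act_csmul (c : ℂ) (S : EndSec V F E) (s : Sec V F E) :
    EndSec.act (c • S) s = c • EndSec.act S s := rfl

theorem EndSec.ext_act' {S T : EndSec V F E}
    (h : ∀ s, EndSec.act S s = EndSec.act T s) : S = T :=
  EndSec.ext_act fun s x => by rw [h s]

/-- The map `𝒜(E) → Der(𝔄)`, which maps `T` to the derivation `S ↦ [T, S]`. -/
def toDer : Atiyah V F E →ₗ[CInf V M] Der V F E where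
  toFun T := ⟨{ toFun := commEnd T
                map_add' S S' := EndSec.ext_act' fun s => by
                  simp only [act_commEnd, map_add, LinearMap.add_apply]
                  abel
                map_smul' c S := EndSec.ext_act' fun s => by
                  simp only [act_commEnd, act_csmul, map_smul, RingHom.id_apply, smul_sub] },
    fun S S' => EndSec.ext_act' fun s => by
      change EndSec.act (commEnd T (S * S')) s = EndSec.act (commEnd T S * S' + S * commEnd T S') s
      simp only [act_commEnd, act_mul, map_add, LinearMap.add_apply, map_sub]
      abel⟩
  map_add' T T' := by
    ext1 S
    refine EndSec.ext_act' fun s => ?_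
    change EndSec.act (commEnd (T + T') S) s = EndSec.act (commEnd T S + commEnd T' S) s
    simp only [act_commEnd, map_add, LinearMap.add_apply, Submodule.coe_add]
    abel
  map_smul' f T := by
    ext1 S
    refine EndSec.ext_act' fun s => ?_
    change EndSec.act (commEnd (f • T) S) s = EndSec.act (f • commEnd T S) s
    simp only [act_commEnd, map_smul, LinearMap.smul_apply, Submodule.coe_smul, smul_sub]

theorem act_toDer (T : Atiyah V F E) (S : EndSec V F E) (s : Sec V F E) :
    EndSec.act ((toDer T).1 S) s = T.1 (EndSec.act S s) - EndSec.act S (T.1 s) :=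
  act_commEnd T S s

variable [Nontrivial F]

theorem rho_toDer {T : Atiyah V F E} {X : VectorField V M} (h : HasSymbol T.1 X) :
    rho (toDer T) = X := by
  refine Derivation.ext fun f => smul_one_injective (F := F) (E := E) ?_
  rw [← rho_spec]
  refine EndSec.ext_act' fun s => ?_
  rw [act_toDer]
  have h1 : ∀ (g : CInf V M) (s : Sec V F E), EndSec.act (g • (1 : EndSec V F E)) s = g • s :=
    fun g s => rfl
  rw [h1, h1, h1, h f s]
  abel

theorem sub_cov_mem_Inn (nabla : Connection V F E) (D : Der V F E) :
    D - toDer (nabla.cov (rho D)) ∈ Inn V F E :=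
  mem_Inn_of_rho_eq_zero (by
    rw [map_sub, rho_toDer (T := nabla.cov (rho D)) (nabla.leibniz _), sub_self])

/-- The noncommutative 1-form of a connection, `α(𝒳) = - iθ(𝒳 - ∇_X)`, where `X = ρ(𝒳)` and
`∇_X S = [∇^E_X, S]` is the induced connection on `End(E)`. -/
def alpha (nabla : Connection V F E) (D : Der V F E) : EndSec V F E :=
  -iTheta ⟨D - toDer (nabla.cov (rho D)), sub_cov_mem_Inn nabla D⟩

/-- The map `D° : Der(𝔄) → 𝒜(E)`, `D°(𝒳) = ∇^E_X - α(𝒳)`, where `X = ρ(𝒳)`. -/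
def Dcirc (nabla : Connection V F E) (D : Der V F E) : Atiyah V F E :=
  nabla.cov (rho D) - incl (alpha nabla D)

/-- A connection in the sense of Lie algebroids, for the Lie algebroid `Der(𝔄)` with anchor `ρ`:
a `C^∞(M)`-linear map to `𝒜(E)` which preserves the anchors. -/
structure IsDerConnection (D : Der V F E → Atiyah V F E) : Prop where
  map_add : ∀ X Y, D (X + Y) = D X + D Y
  map_smul : ∀ (f : CInf V M) X, D (f • X) = f • D X
  anchor : ∀ X, HasSymbol (D X).1 (rho X)

/-- The curvature of a Lie algebroid connection. -/
def curvature (D : Der V F E → Atiyah V F E) (X Y : Der V F E) : Atiyah V F E :=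
  ⁅D X, D Y⁆ - D ⁅X, Y⁆

end Atiyah

end SUBundle

end

open SUBundle

/-! An operator in `𝒜(E)` acts on the complex volume form by the Leibniz rule. Those whose action on
it vanishes form `SUStructure.specialAtiyah`, which is both a `C^∞(M)`-submodule and a Lie
subalgebra. The whole theorem comes from the fact that `toDer` restricts to a bijection from this
subalgebra onto `Der(𝔄)`, with inverse `D°`.

Injectivity. The symbol of `T` is `ρ(toDer T)`. If `toDer T = 0`, then `T` is `C^∞(M)`-linear, hence
an endomorphism of `E`, and it is central in `𝔄`, hence multiplication by a function `f`
(`toDer_eq_zero_iff`). An endomorphism acts on the volume form through its trace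
(`sum_alternating_update_eq_trace`), and the form vanishes nowhere, because it has modulus `1` on
orthonormal frames. So `f • 1` annihilates the form only if it is traceless, which forces `f = 0`
(`SUStructure.toDer_injOn`).

Surjectivity. `∇_X` annihilates the volume form since the connection is unimodular, and `α(𝒳)` does
because it is traceless, so `D°(𝒳)` lies in the subalgebra. It induces `𝒳`, since `ad ∘ iθ` is the
identity on inner derivations.

An inverse of `toDer` does not depend on the connection, and it inherits linearity and compatibility
with brackets from `toDer`. Each identity for `D°` is thus proved by exhibiting a
volume-annihilating operator with the right derivation (`Dcirc_eq`); no curvature is computed. The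
same pattern one level down, with traceless endomorphisms as complement of the scalars in `𝔄`,
handles `iθ` (`eq_of_ad_eq`). The two levels match because `incl γ` annihilates the volume form
exactly when `γ` is traceless. -/

namespace SUBundle

/-! ### Linear algebra: orthonormal bases and the trace on volume forms -/

/-- A positive definite hermitian form is an inner product, so a standard orthonormal basis exists
for the norm that it defines. The index `n` is kept separate from `finrank W` because the volume
form on a fiber is indexed by the rank of the model fiber. -/
theorem exists_basis_orthonormal {W : Type*} [AddCommGroup W] [Module ℂ W]
    [FiniteDimensional ℂ W] {n : ℕ} (hn : Module.finrank ℂ W = n) (h : W →ₗ⋆[ℂ] W →ₗ[ℂ] ℂ)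
    (symm : ∀ u v, starRingEnd ℂ (h u v) = h v u) (pos : ∀ v, v ≠ 0 → 0 < (h v v).re) :
    ∃ b : Module.Basis (Fin n) ℂ W, ∀ i j, h (b i) (b j) = if i = j then 1 else 0 := by
  let c : InnerProductSpace.Core ℂ W :=
    { inner := fun u v => h u v
      conj_inner_symm := fun u v => symm v u
      re_inner_nonneg := fun v => by
        by_cases hv : v = 0
        · simp [hv]
        · exact (pos v hv).le
      add_left := fun u v w => by simp
      smul_left := fun u v r => by simp
      definite := fun v hv => by
        by_contra h0
        have := pos v h0
        rw [show h v v = 0 from hv] at this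
        simp at this }
  let _ : NormedAddCommGroup W := c.toNormedAddCommGroup
  let _ : InnerProductSpace ℂ W := InnerProductSpace.ofCore c.toCore
  let b := (stdOrthonormalBasis ℂ W).reindex (finCongr hn)
  refine ⟨b.toBasis, fun i j => ?_⟩
  have := (orthonormal_iff_ite.1 b.orthonormal) i j
  rw [b.coe_toBasis]
  exact this

/-- A top-degree form is a multiple of the determinant in the basis `b`. If `B` is the matrix of `v`
and `A` also denotes the matrix of the endomorphism, the sum of determinants is `tr(adj(B) A B) =
tr(A B adj(B)) = det(B) tr(A)`. The vectors `v` need not be independent. -/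
theorem sum_alternating_update_eq_trace {K W : Type*} [Field K] [AddCommGroup W] [Module K W]
    {ι : Type*} [Fintype ι] [DecidableEq ι] (b : Module.Basis ι K W) (η : W [⋀^ι]→ₗ[K] K)
    (A : Module.End K W) (v : ι → W) :
    ∑ i, η (Function.update v i (A (v i))) = LinearMap.trace K W A * η v := by
  rw [η.eq_smul_basis_det b]
  simp only [AlternatingMap.smul_apply, Module.Basis.det_apply, smul_eq_mul, ← Finset.mul_sum,
    Module.Basis.toMatrix_update]
  have hA : ∀ i, b.repr (A (v i)) = (LinearMap.toMatrix b b A * b.toMatrix v).col i := fun i => by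
    ext j
    rw [Matrix.col_apply, ← LinearMap.toMatrix_mulVec_repr b b A]
    rfl
  -- By Cramer's rule, replacing column `i` of `B` by column `i` of `AB` gives the `i`-th diagonal
  -- entry of `adj(B) A B`.
  have : ∑ i, ((b.toMatrix v).updateCol i (b.repr (A (v i)))).det =
      ((b.toMatrix v).adjugate * (LinearMap.toMatrix b b A * b.toMatrix v)).trace := by
    refine Finset.sum_congr rfl fun i _ => ?_
    rw [hA, ← Matrix.cramer_apply, Matrix.cramer_eq_adjugate_mulVec]
    rfl
  rw [this, Matrix.trace_mul_comm, Matrix.mul_assoc, Matrix.mul_adjugate, Matrix.mul_smul,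
    Matrix.mul_one, Matrix.trace_smul, LinearMap.trace_eq_matrix_trace K b, smul_eq_mul]
  ring

section

variable {V : Type*} [NormedAddCommGroup V] [NormedSpace ℝ V]
  {M : Type*} [TopologicalSpace M] [ChartedSpace V M]
  {F : Type*} [NormedAddCommGroup F] [NormedSpace ℂ F]
  {E : M → Type*} [TopologicalSpace (TotalSpace F E)] [∀ x, AddCommGroup (E x)]
  [∀ x, Module ℂ (E x)] [∀ x, TopologicalSpace (E x)] [FiberBundle F E] [VectorBundle ℂ F E]
  [ContMDiffVectorBundle ∞ F E 𝓘(ℝ, V)]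

/-! ### The volume form as a multilinear map on sections -/

theorem SUStructure.volume_apply_update (σ : SUStructure V F E)
    (s : Fin (Module.finrank ℂ F) → Sec V F E) (i : Fin (Module.finrank ℂ F)) (t : Sec V F E)
    (x : M) : σ.volume (Function.update s i t) x =
      σ.vol x (Function.update (fun j => s j x) i (t x)) := by
  refine congrArg (σ.vol x) (funext fun j => ?_)
  by_cases h : j = i
  · subst h; simp
  · simp [h]

theorem SUStructure.volume_update_add (σ : SUStructure V F E)
    (s : Fin (Module.finrank ℂ F) → Sec V F E) (i : Fin (Module.finrank ℂ F)) (t u : Sec V F E) :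
    σ.volume (Function.update s i (t + u)) =
      σ.volume (Function.update s i t) + σ.volume (Function.update s i u) := by
  ext x
  simp [SUStructure.volume_apply_update]

theorem SUStructure.volume_update_sub (σ : SUStructure V F E)
    (s : Fin (Module.finrank ℂ F) → Sec V F E) (i : Fin (Module.finrank ℂ F)) (t u : Sec V F E) :
    σ.volume (Function.update s i (t - u)) =
      σ.volume (Function.update s i t) - σ.volume (Function.update s i u) := by
  ext x
  simp [SUStructure.volume_apply_update]

theorem SUStructure.volume_update_smul (σ : SUStructure V F E)
    (s : Fin (Module.finrank ℂ F) → Sec V F E) (i : Fin (Module.finrank ℂ F)) (f : CInf V M)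
    (t : Sec V F E) :
    σ.volume (Function.update s i (f • t)) = f * σ.volume (Function.update s i t) := by
  ext x
  simp [SUStructure.volume_apply_update]

theorem CInf.sum_apply {ι : Type*} (t : Finset ι) (f : ι → CInf V M) (x : M) :
    (∑ i ∈ t, f i) x = ∑ i ∈ t, f i x := by
  classical
  induction t using Finset.induction_on with
  | empty => simp
  | insert a t ha ih => rw [Finset.sum_insert ha, Finset.sum_insert ha, CInf.add_apply, ih]

/-- `T` is a lift of the vector field `X` which annihilates the volume form. -/
def SUStructure.Preserves (σ : SUStructure V F E) (T : Module.End ℂ (Sec V F E))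
    (X : VectorField V M) : Prop :=
  ∀ s : Fin (Module.finrank ℂ F) → Sec V F E,
    X (σ.volume s) = ∑ i, σ.volume (Function.update s i (T (s i)))

/-- Expanding `X (X' vol(s))` gives diagonal terms, with `T T'` in one slot, and mixed terms, with
`T'` and `T` in two different slots. The mixed terms are symmetric under exchanging the two
operators, so they cancel in the commutator. -/
theorem SUStructure.Preserves.lie {σ : SUStructure V F E} {T T' : Module.End ℂ (Sec V F E)}
    {X X' : VectorField V M} (h : σ.Preserves T X) (h' : σ.Preserves T' X') :
    σ.Preserves (T * T' - T' * T) ⁅X, X'⁆ := by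
  have second : ∀ {T T' : Module.End ℂ (Sec V F E)} {X X' : VectorField V M},
      σ.Preserves T X → σ.Preserves T' X' → ∀ s : Fin (Module.finrank ℂ F) → Sec V F E,
      X (X' (σ.volume s)) = ∑ i, σ.volume (Function.update s i (T (T' (s i)))) +
        ∑ i, ∑ k ∈ Finset.univ.erase i,
          σ.volume (Function.update (Function.update s i (T' (s i))) k (T (s k))) := by
    intro T T' X X' h h' s
    rw [h' s, map_sum, ← Finset.sum_add_distrib]
    refine Finset.sum_congr rfl fun i _ => ?_
    -- The term in which `T` hits the slot already modified by `T'` is split off as the diagonal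
    -- term.
    rw [h, ← Finset.add_sum_erase _ _ (Finset.mem_univ i)]
    congr 1
    · simp
    · refine Finset.sum_congr rfl fun k hk => ?_
      rw [Function.update_of_ne (Finset.ne_of_mem_erase hk)]
  intro s
  rw [Derivation.commutator_apply, second h h', second h' h]
  -- The ordered pairs of distinct slots are reindexed by exchanging `i` and `k`; updates in
  -- distinct slots commute.
  have swap : ∑ i, ∑ k ∈ Finset.univ.erase i,
        σ.volume (Function.update (Function.update s i (T' (s i))) k (T (s k))) =
      ∑ i, ∑ k ∈ Finset.univ.erase i,
        σ.volume (Function.update (Function.update s i (T (s i))) k (T' (s k))) := by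
    rw [Finset.sum_comm' (t' := Finset.univ) (s' := fun k => Finset.univ.erase k)
      (by intro x y; simp [eq_comm])]
    refine Finset.sum_congr rfl fun k _ => Finset.sum_congr rfl fun i hi => ?_
    rw [Function.update_comm (Finset.ne_of_mem_erase hi)]
  rw [swap, add_sub_add_right_eq_sub, ← Finset.sum_sub_distrib]
  refine Finset.sum_congr rfl fun i _ => ?_
  rw [← SUStructure.volume_update_sub]
  rfl

/-! ### Traces and nonvanishing of the volume form in the fibers -/

variable [FiniteDimensional ℂ F]

variable (F E) in
/-- The fiber at `x` is isomorphic to the model fiber. -/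
noncomputable def fiberEquiv (x : M) : E x ≃ₗ[ℂ] F :=
  (trivializationAt F E x).linearEquivAt ℂ x (FiberBundle.mem_baseSet_trivializationAt' x)

theorem EndSec.tr_traceless [Nontrivial F] (γ : EndSec V F E) :
    EndSec.tr (EndSec.traceless γ) = 0 := by
  ext x
  have hn : (Module.finrank ℂ F : ℂ) ≠ 0 := by exact_mod_cast Module.finrank_pos.ne'
  have : Module.Finite ℂ (E x) := Module.Finite.equiv (fiberEquiv F E x).symm
  change LinearMap.trace ℂ (E x) (γ x -
    ((Module.finrank ℂ F : ℂ)⁻¹ * LinearMap.trace ℂ (E x) (γ x)) • 1) = 0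
  rw [map_sub, map_smul, LinearMap.trace_one, (fiberEquiv F E x).finrank_eq, smul_eq_mul]
  field_simp
  ring

theorem EndSec.tr_mul_comm (S T : EndSec V F E) : EndSec.tr (S * T) = EndSec.tr (T * S) := by
  ext x
  exact LinearMap.trace_mul_comm ℂ (S x) (T x)

/-- This is where compatibility of metric and volume form enters: on an orthonormal basis the form
has modulus `1`. -/
theorem SUStructure.exists_basis_vol_ne_zero (σ : SUStructure V F E) (x : M) :
    ∃ b : Module.Basis (Fin (Module.finrank ℂ F)) ℂ (E x), σ.vol x b ≠ 0 := by
  have : Module.Finite ℂ (E x) := Module.Finite.equiv (fiberEquiv F E x).symm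
  obtain ⟨b, hb⟩ := exists_basis_orthonormal (fiberEquiv F E x).finrank_eq (σ.h x)
    (σ.h_symm x) (σ.h_pos x)
  refine ⟨b, fun h0 => ?_⟩
  have := σ.vol_norm x b hb
  simp [h0] at this

/-- The trace identity for top-degree forms applies in each fiber; any basis with the right index
type serves there. -/
theorem SUStructure.sum_volume_update_act (σ : SUStructure V F E) (S : EndSec V F E)
    (s : Fin (Module.finrank ℂ F) → Sec V F E) :
    ∑ i, σ.volume (Function.update s i (EndSec.act S (s i))) = EndSec.tr S * σ.volume s := by
  ext x
  obtain ⟨b, -⟩ := σ.exists_basis_vol_ne_zero x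
  rw [CInf.sum_apply, CInf.mul_apply, EndSec.tr_apply]
  simp only [SUStructure.volume_apply_update, EndSec.act_apply]
  change _ = _ * σ.vol x (fun i => s i x)
  exact sum_alternating_update_eq_trace b _ _ _

theorem scalarEnd_apply (f : CInf V M) : scalarEnd V F E f = f • (1 : EndSec V F E) :=
  Algebra.algebraMap_eq_smul_one f

theorem ad_scalarEnd (f : CInf V M) : ad (scalarEnd V F E f) = 0 :=
  Der.ext fun S => by
    rw [ad_apply]
    exact sub_eq_zero.2 (Algebra.commutes f S)

theorem tr_iTheta [Nontrivial F] (δ : Inn V F E) : EndSec.tr (iTheta δ) = 0 := EndSec.tr_traceless _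

variable [FiniteDimensional ℝ V] [T2Space M] [IsManifold 𝓘(ℝ, V) ∞ M]

/-- A basis of the fiber at `x` with nonzero volume extends to global sections, so the factor
`vol(s)` can be cancelled at each point. -/
theorem SUStructure.eq_zero_of_forall_volume (σ : SUStructure V F E) {f : CInf V M}
    (h : ∀ s, f * σ.volume s = 0) : f = 0 := by
  ext x
  obtain ⟨b, hb⟩ := σ.exists_basis_vol_ne_zero x
  have h1 := congrArg (fun g : CInf V M => g x) (h fun i => extend x (b i))
  have h2 : σ.volume (fun i => extend x (b i)) x = σ.vol x b := by
    refine congrArg (σ.vol x) (funext fun i => ?_)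
    exact extend_apply x (b i)
  simpa [h2, hb] using h1

/-! ### Commutators and the maps of the two exact sequences -/

theorem toDer_incl (S : EndSec V F E) : toDer (incl S) = ad S :=
  Der.ext fun S' => EndSec.ext_act' fun s => by
    rw [act_toDer, ad_apply, map_sub, LinearMap.sub_apply, act_mul, act_mul, incl_apply, incl_apply]

theorem toDer_lie (T T' : Atiyah V F E) : toDer ⁅T, T'⁆ = ⁅toDer T, toDer T'⁆ :=
  Der.ext fun S => EndSec.ext_act' fun s => by
    rw [Der.bracket_apply, map_sub, LinearMap.sub_apply]
    simp only [act_toDer, Atiyah.bracket_apply, map_sub]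
    abel

theorem lie_scalarAtiyah (f g : CInf V M) : ⁅scalarAtiyah V F E f, scalarAtiyah V F E g⁆ = 0 :=
  Atiyah.ext fun s => by
    rw [Atiyah.bracket_apply]
    change EndSec.act (scalarEnd V F E f) (EndSec.act (scalarEnd V F E g) s) -
      EndSec.act (scalarEnd V F E g) (EndSec.act (scalarEnd V F E f) s) = 0
    rw [← act_mul, ← act_mul, scalarEnd, Algebra.linearMap_apply, Algebra.commutes, sub_self]

/-! ### Kernels of `ad` and `toDer`, and the splitting `iθ` -/

variable [Nontrivial F]

theorem scalarEnd_injective : Function.Injective (scalarEnd V F E) := fun f g h =>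
  smul_one_injective (F := F) (E := E) (by rwa [scalarEnd_apply, scalarEnd_apply] at h)

theorem ad_eq_zero_iff {γ : EndSec V F E} : ad γ = 0 ↔ ∃ f, scalarEnd V F E f = γ := by
  refine ⟨fun h => ⟨(Module.finrank ℂ F : ℂ)⁻¹ • EndSec.tr γ, ?_⟩, ?_⟩
  · have := eq_tr_of_central (z := γ) fun S =>
      sub_eq_zero.1 (congrArg (fun D : Der V F E => D.1 S) h)
    conv_rhs => rw [this]
    rw [scalarEnd_apply]
  · rintro ⟨f, rfl⟩
    exact ad_scalarEnd f

theorem ad_traceless (γ : EndSec V F E) : ad (EndSec.traceless γ) = ad γ := by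
  rw [← sub_eq_zero, ← map_sub, ad_eq_zero_iff]
  refine ⟨-((Module.finrank ℂ F : ℂ)⁻¹ • EndSec.tr γ), ?_⟩
  rw [scalarEnd_apply, neg_smul]
  change _ = γ - ((Module.finrank ℂ F : ℂ)⁻¹ • EndSec.tr γ) • (1 : EndSec V F E) - γ
  abel

/-- A traceless endomorphism is determined by its inner derivation. -/
theorem eq_of_ad_eq {γ γ' : EndSec V F E} (h : ad γ = ad γ') (hγ : EndSec.tr γ = 0)
    (hγ' : EndSec.tr γ' = 0) : γ = γ' := by
  -- The difference is central, hence equal to its normalized trace times `1`, and this trace is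
  -- zero.
  have hz := eq_tr_of_central (z := γ - γ') fun S => sub_eq_zero.1
    (congrArg (fun D : Der V F E => D.1 S) (show ad (γ - γ') = 0 by rw [map_sub, h, sub_self]))
  rw [map_sub, hγ, hγ', sub_self, smul_zero, zero_smul] at hz
  exact sub_eq_zero.1 hz

theorem ad_iTheta (δ : Inn V F E) : ad (iTheta δ) = δ.1 :=
  (ad_traceless _).trans δ.2.choose_spec

/-- `iTheta` is defined through a chosen preimage under `ad`, so linearity is not visible from the
formula. It follows because both sides are traceless and have the same `ad`. -/
theorem iTheta_add (δ δ' : Inn V F E) : iTheta (δ + δ') = iTheta δ + iTheta δ' :=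
  eq_of_ad_eq (by simp [ad_iTheta]) (tr_iTheta _) (by simp [tr_iTheta])

theorem iTheta_smul (f : CInf V M) (δ : Inn V F E) : iTheta (f • δ) = f • iTheta δ :=
  eq_of_ad_eq (by simp [ad_iTheta]) (tr_iTheta _) (by simp [tr_iTheta])

/-- A commutator has trace zero, so the right-hand side is again the traceless preimage under `ad`.
-/
theorem iTheta_lie (δ δ' : Inn V F E) :
    iTheta ⁅δ, δ'⁆ = iTheta δ * iTheta δ' - iTheta δ' * iTheta δ := by
  refine eq_of_ad_eq ?_ (tr_iTheta _) ?_
  · rw [ad_iTheta, ← lie_ad, ad_iTheta, ad_iTheta]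
    rfl
  · rw [map_sub, EndSec.tr_mul_comm, sub_self]

theorem scalarAtiyah_injective : Function.Injective (scalarAtiyah V F E) := fun f g h => by
  apply scalarEnd_injective (F := F) (E := E)
  refine EndSec.ext_act' fun s => ?_
  exact congrArg (fun T : Atiyah V F E => T.1 s) h

/-- The symbol is read off from the action on the center, so it vanishes when `toDer T = 0`.
Tensoriality then turns `T` into an element of `𝔄`, which commutes with all of `𝔄`. -/
theorem toDer_eq_zero_iff {T : Atiyah V F E} : toDer T = 0 ↔ ∃ f, scalarAtiyah V F E f = T := by
  refine ⟨fun h => ?_, ?_⟩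
  · obtain ⟨X, hX⟩ := T.2
    have hX0 : X = 0 := by rw [← rho_toDer (T := T) hX, h, map_zero]
    let S : EndSec V F E := ofTensorial
      { toFun := T.1
        map_add' := map_add T.1
        map_smul' f s := by rw [hX f s, hX0]; simp }
    have hS : incl S = T := Atiyah.ext fun s => by
      rw [incl_apply, act_ofTensorial]
      rfl
    obtain ⟨f, hf⟩ := ad_eq_zero_iff.1 (show ad S = 0 by rw [← toDer_incl, hS, h])
    exact ⟨f, by rw [scalarAtiyah, LinearMap.comp_apply, hf, hS]⟩
  · rintro ⟨f, rfl⟩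
    rw [scalarAtiyah, LinearMap.comp_apply, toDer_incl, ad_scalarEnd]

/-! ### The volume-preserving part of the Atiyah algebra -/

/-- The operators in `𝒜(E)` which annihilate the volume form. -/
def SUStructure.specialAtiyah (σ : SUStructure V F E) : Submodule (CInf V M) (Atiyah V F E) where
  -- `rho (toDer T)` is the symbol of `T`, written so that it depends linearly on `T` without a
  -- choice.
  carrier := {T | σ.Preserves T.1 (rho (toDer T))}
  add_mem' {T T'} h h' s := by
    rw [map_add, map_add, Derivation.add_apply, h s, h' s, ← Finset.sum_add_distrib]
    refine Finset.sum_congr rfl fun i _ => ?_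
    rw [← SUStructure.volume_update_add]
    rfl
  zero_mem' s := by
    rw [map_zero, map_zero]
    refine (Finset.sum_eq_zero fun i _ => ?_).symm
    have := σ.volume_update_smul s i 0 0
    rwa [zero_smul, zero_mul] at this
  smul_mem' f T h s := by
    rw [map_smul, map_smul, Derivation.smul_apply, h s, smul_eq_mul, Finset.mul_sum]
    refine Finset.sum_congr rfl fun i _ => ?_
    rw [← SUStructure.volume_update_smul]
    rfl

theorem rho_lie (D D' : Der V F E) : rho ⁅D, D'⁆ = ⁅rho D, rho D'⁆ :=
  Derivation.ext fun f => smul_one_injective (F := F) (E := E) (by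
    rw [← rho_spec, Der.bracket_apply, rho_spec, rho_spec, rho_spec, rho_spec, ← sub_smul,
      Derivation.commutator_apply])

theorem SUStructure.lie_mem_specialAtiyah {σ : SUStructure V F E} {T T' : Atiyah V F E}
    (h : T ∈ σ.specialAtiyah) (h' : T' ∈ σ.specialAtiyah) : ⁅T, T'⁆ ∈ σ.specialAtiyah := by
  change σ.Preserves (T.1 * T'.1 - T'.1 * T.1) (rho (toDer ⁅T, T'⁆))
  rw [toDer_lie, rho_lie]
  exact SUStructure.Preserves.lie h h'

theorem rho_ad (γ : EndSec V F E) : rho (ad γ) = 0 := by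
  rw [← toDer_incl]
  exact rho_toDer fun f s => by simp

/-- The symbol of `incl γ` is zero, so the condition becomes `0 = Tr(γ) vol(s)` for all `s`, and the
volume form vanishes nowhere. -/
theorem SUStructure.incl_mem_specialAtiyah (σ : SUStructure V F E) {γ : EndSec V F E} :
    incl γ ∈ σ.specialAtiyah ↔ EndSec.tr γ = 0 := by
  have key : incl γ ∈ σ.specialAtiyah ↔ ∀ s, 0 = EndSec.tr γ * σ.volume s := by
    refine forall_congr' fun s => ?_
    rw [toDer_incl, rho_ad, ← σ.sum_volume_update_act]
    rfl
  rw [key]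
  exact ⟨fun h => σ.eq_zero_of_forall_volume fun s => (h s).symm, fun h s => by rw [h, zero_mul]⟩

/-- An operator which annihilates the volume form is determined by its derivation of `𝔄`. -/
theorem SUStructure.toDer_injOn (σ : SUStructure V F E) {T T' : Atiyah V F E}
    (hT : T ∈ σ.specialAtiyah) (hT' : T' ∈ σ.specialAtiyah) (h : toDer T = toDer T') : T = T' := by
  obtain ⟨f, hf⟩ := toDer_eq_zero_iff.1 (show toDer (T - T') = 0 by rw [map_sub, h, sub_self])
  -- `T - T'` is multiplication by `f` and annihilates the volume form, so `f • 1` is traceless;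
  -- being central too, it must be `0`.
  have h1 := σ.specialAtiyah.sub_mem hT hT'
  rw [← hf, scalarAtiyah, LinearMap.comp_apply, σ.incl_mem_specialAtiyah] at h1
  have h2 : scalarEnd V F E f = 0 := eq_of_ad_eq (by rw [ad_scalarEnd, map_zero]) h1 (map_zero _)
  rw [← sub_eq_zero, ← hf, scalarAtiyah, LinearMap.comp_apply, h2, map_zero]

/-! ### The map `D°` as inverse of `toDer` on volume-annihilating operators -/

theorem toDer_Dcirc (nabla : Connection V F E) (D : Der V F E) : toDer (Dcirc nabla D) = D := by
  -- The two signs cancel: `∇_X` contributes its own derivation, and `iθ(𝒳 - ∇_X)` contributes the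
  -- missing inner part `𝒳 - ∇_X`.
  rw [Dcirc, alpha, map_neg, sub_neg_eq_add, map_add, toDer_incl, ad_iTheta]
  exact add_sub_cancel _ _

theorem Dcirc_mem_specialAtiyah {σ : SUStructure V F E} (nabla : SUConnection σ) (D : Der V F E) :
    Dcirc nabla.toConnection D ∈ σ.specialAtiyah := by
  refine σ.specialAtiyah.sub_mem ?_ (σ.incl_mem_specialAtiyah.2 ?_)
  · intro s
    rw [rho_toDer (T := nabla.cov (rho D)) (nabla.leibniz _)]
    exact nabla.unimodular _ s
  · rw [alpha, map_neg, tr_iTheta, neg_zero]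

/-- The characterization of `D°(𝒳)` used from here on: it is the only volume-annihilating operator
that induces `𝒳`. The criterion on `T` does not involve the connection. -/
theorem Dcirc_eq {σ : SUStructure V F E} (nabla : SUConnection σ) {D : Der V F E}
    {T : Atiyah V F E} (hT : T ∈ σ.specialAtiyah) (h : toDer T = D) :
    Dcirc nabla.toConnection D = T :=
  σ.toDer_injOn (Dcirc_mem_specialAtiyah nabla D) hT ((toDer_Dcirc _ D).trans h.symm)

theorem hasSymbol_rho_toDer (T : Atiyah V F E) : HasSymbol T.1 (rho (toDer T)) := by
  obtain ⟨X, hX⟩ := T.2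
  rwa [rho_toDer (T := T) hX]

theorem Dcirc_add {σ : SUStructure V F E} (nabla : SUConnection σ) (X Y : Der V F E) :
    Dcirc nabla.toConnection (X + Y) =
      Dcirc nabla.toConnection X + Dcirc nabla.toConnection Y :=
  Dcirc_eq nabla (σ.specialAtiyah.add_mem (Dcirc_mem_specialAtiyah nabla X)
    (Dcirc_mem_specialAtiyah nabla Y)) (by rw [map_add, toDer_Dcirc, toDer_Dcirc])

theorem Dcirc_smul {σ : SUStructure V F E} (nabla : SUConnection σ) (f : CInf V M)
    (X : Der V F E) :
    Dcirc nabla.toConnection (f • X) = f • Dcirc nabla.toConnection X :=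
  Dcirc_eq nabla (σ.specialAtiyah.smul_mem f (Dcirc_mem_specialAtiyah nabla X))
    (by rw [map_smul, toDer_Dcirc])

theorem Dcirc_lie {σ : SUStructure V F E} (nabla : SUConnection σ) (X Y : Der V F E) :
    Dcirc nabla.toConnection ⁅X, Y⁆ =
      ⁅Dcirc nabla.toConnection X, Dcirc nabla.toConnection Y⁆ :=
  Dcirc_eq nabla (SUStructure.lie_mem_specialAtiyah (Dcirc_mem_specialAtiyah nabla X)
    (Dcirc_mem_specialAtiyah nabla Y)) (by rw [toDer_lie, toDer_Dcirc, toDer_Dcirc])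

end

end SUBundle

/-! ### The theorem -/

theorem mainTheorem4
    {V : Type*} [NormedAddCommGroup V] [NormedSpace ℝ V] [FiniteDimensional ℝ V]
    {M : Type*} [TopologicalSpace M] [ChartedSpace V M] [IsManifold 𝓘(ℝ, V) ∞ M]
    [T2Space M] [ParacompactSpace M]
    {F : Type*} [NormedAddCommGroup F] [NormedSpace ℂ F] [FiniteDimensional ℂ F] [Nontrivial F]
    {E : M → Type*} [TopologicalSpace (TotalSpace F E)] [∀ x, AddCommGroup (E x)]
    [∀ x, Module ℂ (E x)] [∀ x, TopologicalSpace (E x)] [FiberBundle F E] [VectorBundle ℂ F E]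
    [ContMDiffVectorBundle ∞ F E 𝓘(ℝ, V)]
    (σ : SUStructure V F E) :
    -- `D°` does not depend on the choice of the `SU(n)`-connection
    (∀ nabla nabla' : SUConnection σ,
      Dcirc nabla.toConnection = Dcirc nabla'.toConnection) ∧
    -- `0 → C^∞(M) → 𝔄 → Int(𝔄) → 0` is an exact sequence of modules and Lie algebras,
    -- and `iθ` splits it as such
    (Function.Injective (scalarEnd V F E) ∧
      Function.Exact (scalarEnd V F E) (adInn (V := V) (F := F) (E := E)) ∧
      Function.Surjective (adInn (V := V) (F := F) (E := E)) ∧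
      (∀ f g : CInf V M, scalarEnd V F E f * scalarEnd V F E g -
        scalarEnd V F E g * scalarEnd V F E f = 0) ∧
      (∀ γ γ' : EndSec V F E, adInn (γ * γ' - γ' * γ) = ⁅adInn γ, adInn γ'⁆)) ∧
    ((∀ δ : Inn V F E, adInn (iTheta δ) = δ) ∧
      (∀ δ δ' : Inn V F E, iTheta (δ + δ') = iTheta δ + iTheta δ') ∧
      (∀ (f : CInf V M) (δ : Inn V F E), iTheta (f • δ) = f • iTheta δ) ∧
      (∀ δ δ' : Inn V F E, iTheta ⁅δ, δ'⁆ = iTheta δ * iTheta δ' - iTheta δ' * iTheta δ)) ∧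
    ∀ nabla : SUConnection σ,
      -- `0 → C^∞(M) → 𝒜(E) → Der(𝔄) → 0` is an exact sequence of modules and Lie algebras
      (Function.Injective (scalarAtiyah V F E) ∧
        Function.Exact (scalarAtiyah V F E) (toDer (V := V) (F := F) (E := E)) ∧
        Function.Surjective (toDer (V := V) (F := F) (E := E)) ∧
        (∀ f g : CInf V M, ⁅scalarAtiyah V F E f, scalarAtiyah V F E g⁆ = 0) ∧
        (∀ T T' : Atiyah V F E, toDer ⁅T, T'⁆ = ⁅toDer T, toDer T'⁆)) ∧
      -- `D°` splits it as such
      ((∀ X : Der V F E, toDer (Dcirc nabla.toConnection X) = X) ∧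
        (∀ X Y : Der V F E, Dcirc nabla.toConnection (X + Y) =
          Dcirc nabla.toConnection X + Dcirc nabla.toConnection Y) ∧
        (∀ (f : CInf V M) (X : Der V F E), Dcirc nabla.toConnection (f • X) =
          f • Dcirc nabla.toConnection X) ∧
        (∀ X Y : Der V F E, Dcirc nabla.toConnection ⁅X, Y⁆ =
          ⁅Dcirc nabla.toConnection X, Dcirc nabla.toConnection Y⁆)) ∧
      -- `D°` induces the splitting `iθ`
      (∀ δ : Inn V F E, Dcirc nabla.toConnection δ = incl (iTheta δ)) ∧
      -- `D°` is a flat `Der(𝔄)`-connection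
      IsDerConnection (Dcirc nabla.toConnection) ∧
      ∀ X Y : Der V F E, curvature (Dcirc nabla.toConnection) X Y = 0 := by
  refine ⟨fun nabla nabla' => funext fun D => Dcirc_eq nabla (Dcirc_mem_specialAtiyah nabla' D)
      (toDer_Dcirc _ D), ⟨scalarEnd_injective, fun γ => ?_, LinearMap.surjective_rangeRestrict _,
      fun f g => ?_, fun γ γ' => Subtype.ext (lie_ad γ γ').symm⟩,
    ⟨fun δ => Subtype.ext (ad_iTheta δ), iTheta_add, iTheta_smul, iTheta_lie⟩,
    fun nabla => ⟨⟨scalarAtiyah_injective, fun T => toDer_eq_zero_iff,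
      -- Surjectivity of `toDer` is where the given connection is needed: `D°` supplies the
      -- preimage.
      fun D => ⟨_, toDer_Dcirc nabla.toConnection D⟩, lie_scalarAtiyah, toDer_lie⟩,
      ⟨toDer_Dcirc _, Dcirc_add nabla, Dcirc_smul nabla, Dcirc_lie nabla⟩,
      -- `iθ(δ)` is traceless, so its inclusion annihilates the volume form; the remaining goal is
      -- that it induces `δ`.
      fun δ => Dcirc_eq nabla (σ.incl_mem_specialAtiyah.2 (tr_iTheta δ)) ?_,
      ⟨Dcirc_add nabla, Dcirc_smul nabla, fun D => ?_⟩, fun X Y => ?_⟩⟩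
  · exact Subtype.ext_iff.trans ad_eq_zero_iff
  · exact sub_eq_zero.2 (Algebra.commutes f _)
  · rw [toDer_incl, ad_iTheta]
  -- The anchor of an operator is determined by the derivation that it induces, which here is `D`
  -- itself.
  · have h := hasSymbol_rho_toDer (Dcirc nabla.toConnection D)
    rwa [toDer_Dcirc] at h
  · rw [curvature, Dcirc_lie, sub_self]
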